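/- **Setting.** For each $N\ge 0$ let $D=D_N\in\mathbb N$, $\theta^*=\theta^*_N\in\mathbb R^{D}$, $S=\operatorname{supp}\theta^*$, $d_{\mathrm{eff}}=|S|$, $\lambda=\lambda_N\in\mathbb R$, and let $(x_n,\varepsilon_n)_{n=1}^N$ be i.i.d. random pairs in $\mathbb R^D\times\mathbb R$ on some probability space; put $y_n=x_n^T\theta^*+\varepsilon_n$, $f(z,y)=\tfrac12(z-y)^2$ and $F(\theta)=\frac1N\sum_{n=1}^N f(x_n^T\theta,y_n)$. A random variable $V$ is $c$-sub-Gaussian if $\mathbb E\exp(V^2/c^2)\le 2$. Let $$\hat\theta=\arg\min_{\theta\in\mathbb R^D}F(\theta)+\lambda\|\theta\|_1,\qquad \hat\theta_{\backslash n}=\arg\min_{\theta\in\mathbb R^D}\tfrac1N\sum_{m\ne n}f(x_m^T\theta,y_m)+\lambda\|\theta\|_1 .$$ With $\hat S=\operatorname{supp}\hat\theta$, $H=\nabla^2F=\frac1N\sum_m x_mx_m^T$ and $g_n=\nabla_\theta f(x_n^T\hat\theta,y_n)=(x_n^T\hat\theta-y_n)x_n$, the approximations $\mathrm{IJ}_{\backslash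 n}$ and $\mathrm{NS}_{\backslash n}$ are the vectors that vanish outside $\hat S$ and equal on $\hat S$, respectively, $$\hat\theta_{\hat S}+\tfrac1N H_{\hat S\hat S}^{-1}(g_n)_{\hat S}\qquad\text{and}\qquad \hat\theta_{\hat S}+\tfrac1N\big(H_{\hat S\hat S}-\tfrac1N (x_nx_n^T)_{\hat S\hat S}\big)^{-1}(g_n)_{\hat S}.$$ **Constants.** For constants $C,C'>0$ and $c_x,c_\varepsilon,\alpha>0$ write $\Delta_N=N-3c_x^2\sqrt N(\sqrt{d_{\mathrm{eff}}}+5)$, $$M_J=\frac{C d_{\mathrm{eff}}\big(\sqrt{50c_x^2}+\sqrt{2c_x^2\log(N(D-d_{\mathrm{eff}}))}\big)\big(\sqrt{d_{\mathrm{eff}}}+\sqrt{50c_x^4}+\sqrt{2c_x^4\log N}\big)}{\Delta_N}$$ $$\qquad+\frac{C d_{\mathrm{eff}}\big(d_{\mathrm{eff}}+d_{\mathrm{eff}}c_x^2(\log N+26)\big)\big(\sqrt N+\sqrt{50c_x^4}+\sqrt{2c_x^4\log(D-d_{\mathrm{eff}})}\big)\big(\sqrt{Nd_{\mathrm{eff}}}+\sqrt{50c_x^4}\big)}{\Delta_N^2}$$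 (with the convention $\log 0=0$), and $\gamma=\alpha-M_J$, $\;L_{\min}=1-3Cc_x^2(\sqrt{d_{\mathrm{eff}}}+5)/\sqrt N$, $\;T_{\min}=(\gamma+4)/L_{\min}$. **Theorem.** There are absolute constants $C,C'>0$ such that the following holds for all $c_x,c_\varepsilon,\alpha>0$ and all sequences as above. Assume: 1. for every $N$, all the entries $x_{nd}$ are i.i.d. and $c_x$-sub-Gaussian with $\mathbb E x_{nd}=0$, $\mathbb E x_{nd}^2=1$; each $\varepsilon_n$ is $c_\varepsilon$-sub-Gaussian; and $\theta^*$ minimizes the population loss $\theta\mapsto\mathbb E f(x_n^T\theta,y_n)$ (which is automatic if $\varepsilon_n$ is independent of $x_n$); 2. (incoherence) for all large $N$, with probability at least $1-e^{-25}$ the matrix $\nabla^2F_{SS}$ is invertible and $\|\nabla^2F_{S^cS}(\nabla^2F_{SS})^{-1}\|_\infty<1-\alpha$, where $\|\cdot\|_\infty$ is the maximal $\ell_1$ norm of a row; 3. (growth) as $N\to\infty$, $D=o(e^N)$, $d_{\mathrm{eff}}=o([N/\log N]^{2/5})$ and $d_{\mathrm{eff}}^{3/2}\sqrt{\log D}=o(N)$;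 4. (beta-min) for all large $N$, $|\theta^*_s|>\sqrt{d_{\mathrm{eff}}}\,T_{\min}\,\lambda$ for every $s\in S$; 5. for all large $N$, $$\lambda\ \ge\ \frac1{\alpha-M_J}\sqrt{\frac{c_x^2c_\varepsilon^2\log D}{NC'}+\frac{25c_x^2c_\varepsilon^2}{NC'}}+\frac{4c_xc_\varepsilon(\log(ND)+26)}{N(\alpha-M_J)} .$$ Then $M_J\to0$ as $N\to\infty$, and for all sufficiently large $N$, with probability at least $1-26e^{-25}$ over the data: $\hat\theta$ and all $\hat\theta_{\backslash n}$ exist and are unique, the matrices inverted in the definitions of $\mathrm{IJ}_{\backslash n}$ and $\mathrm{NS}_{\backslash n}$ are invertible, and $$\operatorname{supp}\mathrm{IJ}_{\backslash n}=\operatorname{supp}\mathrm{NS}_{\backslash n}=\operatorname{supp}\hat\theta_{\backslash n}=S\qquad\text{for all }n=1,\dots,N .$$ -/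

import Mathlib

open MeasureTheory ProbabilityTheory Filter Asymptotics Topology Matrix

namespace SparseLOO

noncomputable section

/-! ### The `ℓ₁`-regularized linear regression problem and its leave-one-out versions

A data set of `N` points in dimension `D` is a matrix `X` of covariates, whose `n`-th row is the
covariate vector of the `n`-th point, together with a vector `y` of responses. -/

/-- The squared loss `f(z, y) = (z - y)² / 2`. -/
def sqLoss (z y : ℝ) : ℝ := (z - y) ^ 2 / 2

/-- The support of a vector, as a finite set of coordinates. -/
def supp {D : ℕ} (θ : Fin D → ℝ) : Finset (Fin D) := Finset.univ.filter fun d => θ d ≠ 0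

/-- `(1/N) ∑_{m ∈ A} f(x_mᵀ θ, y_m)`. With `A` everything this is the full-data loss `F`; with `A`
the complement of `{n}` it is the leave-one-out loss (note the factor `1/N` in both cases). -/
def empLoss {N D : ℕ} (X : Matrix (Fin N) (Fin D) ℝ) (y : Fin N → ℝ) (A : Finset (Fin N))
    (θ : Fin D → ℝ) : ℝ :=
  (1 / (N : ℝ)) * ∑ m ∈ A, sqLoss (X m ⬝ᵥ θ) (y m)

/-- `θ` minimizes `(1/N) ∑_{m ∈ A} f(x_mᵀ θ, y_m) + lam * ‖θ‖₁` over all of `ℝ^D`. -/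
def IsSolution {N D : ℕ} (X : Matrix (Fin N) (Fin D) ℝ) (y : Fin N → ℝ) (lam : ℝ)
    (A : Finset (Fin N)) (θ : Fin D → ℝ) : Prop :=
  ∀ θ' : Fin D → ℝ,
    empLoss X y A θ + lam * ∑ d, |θ d| ≤ empLoss X y A θ' + lam * ∑ d, |θ' d|

/-- `θ` is a solution of the problem on the full data. -/
def IsFullSolution {N D : ℕ} (X : Matrix (Fin N) (Fin D) ℝ) (y : Fin N → ℝ) (lam : ℝ)
    (θ : Fin D → ℝ) : Prop :=
  IsSolution X y lam Finset.univ θ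

/-- `θ` is a solution of the problem with the `n`-th data point left out. -/
def IsLOOSolution {N D : ℕ} (X : Matrix (Fin N) (Fin D) ℝ) (y : Fin N → ℝ) (lam : ℝ)
    (n : Fin N) (θ : Fin D → ℝ) : Prop :=
  IsSolution X y lam (Finset.univ.erase n) θ

/-- The gradient of `θ ↦ f(xᵀ θ, y)`. -/
def gradLoss {D : ℕ} (x : Fin D → ℝ) (y : ℝ) (θ : Fin D → ℝ) : Fin D → ℝ := (x ⬝ᵥ θ - y) • x

/-- The (constant) Hessian of `θ ↦ f(xᵀ θ, y)`. -/
def hessLoss {D : ℕ} (x : Fin D → ℝ) : Matrix (Fin D) (Fin D) ℝ := vecMulVec x x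

/-- `gradLoss` is the gradient: it gives all directional derivatives of the squared loss. -/
theorem hasDerivAt_sqLoss {D : ℕ} (x : Fin D → ℝ) (y : ℝ) (θ v : Fin D → ℝ) :
    HasDerivAt (fun t : ℝ => sqLoss (x ⬝ᵥ (θ + t • v)) y) (gradLoss x y θ ⬝ᵥ v) 0 := by
  have h : HasDerivAt (fun t : ℝ => x ⬝ᵥ θ + t * (x ⬝ᵥ v) - y) (x ⬝ᵥ v) 0 := by
    simpa using (((hasDerivAt_id (0 : ℝ)).mul_const (x ⬝ᵥ v)).const_add (x ⬝ᵥ θ)).sub_const y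
  have h2 := (h.pow 2).div_const 2
  have e : (fun t : ℝ => sqLoss (x ⬝ᵥ (θ + t • v)) y)
      = fun t : ℝ => (x ⬝ᵥ θ + t * (x ⬝ᵥ v) - y) ^ 2 / 2 := by
    funext t
    simp [sqLoss, dotProduct_add, dotProduct_smul]
  have e2 : gradLoss x y θ ⬝ᵥ v = (x ⬝ᵥ θ - y) * (x ⬝ᵥ v) := by
    simp only [gradLoss, smul_dotProduct, smul_eq_mul]
  rw [e, e2]
  refine h2.congr_deriv ?_
  simp
  ring

/-- `hessLoss` is the Hessian: the gradient is affine with this linear part. -/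
theorem gradLoss_add {D : ℕ} (x : Fin D → ℝ) (y : ℝ) (θ v : Fin D → ℝ) :
    gradLoss x y (θ + v) = gradLoss x y θ + hessLoss x *ᵥ v := by
  ext d
  simp [gradLoss, hessLoss, vecMulVec_mulVec, dotProduct_add]
  ring

/-- The Hessian `∇²F = (1/N) ∑_m ∇² f(x_mᵀ θ, y_m)` of the full-data loss (it does not depend on
`θ` or on the responses). -/
def hess {N D : ℕ} (X : Matrix (Fin N) (Fin D) ℝ) : Matrix (Fin D) (Fin D) ℝ :=
  (1 / (N : ℝ)) • ∑ m, hessLoss (X m)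

/-- The block `A_{SS}` of a matrix. -/
def blockSS {D : ℕ} (A : Matrix (Fin D) (Fin D) ℝ) (S : Finset (Fin D)) : Matrix S S ℝ :=
  A.submatrix Subtype.val Subtype.val

/-- The block `A_{Sᶜ S}` of a matrix. -/
def blockScS {D : ℕ} (A : Matrix (Fin D) (Fin D) ℝ) (S : Finset (Fin D)) :
    Matrix {d // d ∉ S} S ℝ :=
  A.submatrix Subtype.val Subtype.val

/-- The vector equal to `θ_S + (1/N) A_{SS}⁻¹ g_S` on the coordinates in `S = supp θ` and to zero
elsewhere. -/
def restrictedStep {D : ℕ} (N : ℕ) (A : Matrix (Fin D) (Fin D) ℝ) (g θ : Fin D → ℝ) :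
    Fin D → ℝ := fun d =>
  if h : d ∈ supp θ then
    θ d + (1 / (N : ℝ)) * ((blockSS A (supp θ))⁻¹ *ᵥ fun s => g s) ⟨d, h⟩
  else 0

/-- The matrix `∇²F - (1/N) ∇² f(x_nᵀ θ, y_n)`. -/
def hessMinus {N D : ℕ} (X : Matrix (Fin N) (Fin D) ℝ) (n : Fin N) :
    Matrix (Fin D) (Fin D) ℝ :=
  hess X - (1 / (N : ℝ)) • hessLoss (X n)

/-- The infinitesimal jackknife approximation to the `n`-th leave-one-out solution, built from a
full-data solution `θ` and run over the coordinates in `supp θ`. -/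
def approxIJ {N D : ℕ} (X : Matrix (Fin N) (Fin D) ℝ) (y : Fin N → ℝ) (θ : Fin D → ℝ)
    (n : Fin N) : Fin D → ℝ :=
  restrictedStep N (hess X) (gradLoss (X n) (y n) θ) θ

/-- The Newton step approximation to the `n`-th leave-one-out solution, built from a full-data
solution `θ` and run over the coordinates in `supp θ`. -/
def approxNS {N D : ℕ} (X : Matrix (Fin N) (Fin D) ℝ) (y : Fin N → ℝ) (θ : Fin D → ℝ)
    (n : Fin N) : Fin D → ℝ :=
  restrictedStep N (hessMinus X n) (gradLoss (X n) (y n) θ) θ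

/-- Support stability: the full-data and leave-one-out solutions are well defined (that is, exist
and are unique), the matrices inverted in the two approximations are invertible, and for every `n`
both approximations and the leave-one-out solution have support exactly `S`. -/
def SupportStable {N D : ℕ} (X : Matrix (Fin N) (Fin D) ℝ) (y : Fin N → ℝ) (lam : ℝ)
    (S : Finset (Fin D)) : Prop :=
  (∃! θ, IsFullSolution X y lam θ) ∧
  (∀ n, ∃! θ, IsLOOSolution X y lam n θ) ∧
  ∀ θhat, IsFullSolution X y lam θhat → ∀ n,
    IsUnit (blockSS (hess X) (supp θhat)).det ∧
    IsUnit (blockSS (hessMinus X n) (supp θhat)).det ∧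
    supp (approxIJ X y θhat n) = S ∧
    supp (approxNS X y θhat n) = S ∧
    ∀ θn, IsLOOSolution X y lam n θn → supp θn = S

/-! ### The statistical model and its assumptions -/

/-- The norm `‖A‖_∞`, the largest `ℓ₁` norm of a row (`0` if there are no rows). -/
def rowSumNorm {m n : Type*} [Fintype m] [Fintype n] (A : Matrix m n ℝ) : ℝ := ⨆ i, ∑ j, |A i j|

/-- The incoherence condition `‖∇²F_{Sᶜ S} (∇²F_{SS})⁻¹‖_∞ < 1 - α`, where the inverse exists. -/
def Incoherent {N D : ℕ} (X : Matrix (Fin N) (Fin D) ℝ) (S : Finset (Fin D)) (α : ℝ) : Prop :=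
  IsUnit (blockSS (hess X) S).det ∧
    rowSumNorm (blockScS (hess X) S * (blockSS (hess X) S)⁻¹) < 1 - α

/-- `V` is `c`-sub-Gaussian: `E exp(V² / c²) ≤ 2`. -/
def IsSubGaussian {Ω : Type*} [MeasurableSpace Ω] (V : Ω → ℝ) (c : ℝ) (μ : Measure Ω) : Prop :=
  ∫⁻ ω, ENNReal.ofReal (Real.exp (V ω ^ 2 / c ^ 2)) ∂μ ≤ 2

/-- The realized matrix of covariates. -/
def design {Ω : Type*} {N D : ℕ} (x : Fin N → Fin D → Ω → ℝ) (ω : Ω) :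
    Matrix (Fin N) (Fin D) ℝ := Matrix.of fun n d => x n d ω

/-- The realized responses `y_n = x_nᵀ θ* + ε_n`. -/
def response {Ω : Type*} {N D : ℕ} (x : Fin N → Fin D → Ω → ℝ) (ε : Fin N → Ω → ℝ)
    (θs : Fin D → ℝ) (ω : Ω) : Fin N → ℝ := fun n => design x ω n ⬝ᵥ θs + ε n ω

/-- The random linear regression model: i.i.d. data points, covariates with i.i.d. zero-mean
unit-variance `cx`-sub-Gaussian entries, `ce`-sub-Gaussian noise, and a true parameter `θs` that
minimizes the population loss. (The last clause holds automatically if the noise is independent of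
the covariates.) -/
structure LinearModel {Ω : Type*} [MeasurableSpace Ω] (μ : Measure Ω) {N D : ℕ}
    (x : Fin N → Fin D → Ω → ℝ) (ε : Fin N → Ω → ℝ) (θs : Fin D → ℝ) (cx ce : ℝ) : Prop where
  measurable_x : ∀ n d, Measurable (x n d)
  measurable_noise : ∀ n, Measurable (ε n)
  indep_points : iIndepFun (fun n ω => ((fun d => x n d ω), ε n ω)) μ
  ident_points : ∀ n m, IdentDistrib (fun ω => ((fun d => x n d ω), ε n ω))
    (fun ω => ((fun d => x m d ω), ε m ω)) μ μ
  indep_x : iIndepFun (fun p : Fin N × Fin D => x p.1 p.2) μ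
  ident_x : ∀ n d m e, IdentDistrib (x n d) (x m e) μ μ
  mean_x : ∀ n d, ∫ ω, x n d ω ∂μ = 0
  second_moment_x : ∀ n d, ∫ ω, x n d ω ^ 2 ∂μ = 1
  subGaussian_x : ∀ n d, IsSubGaussian (x n d) cx μ
  subGaussian_noise : ∀ n, IsSubGaussian (ε n) ce μ
  population_min : ∀ n θ,
    ∫ ω, sqLoss (design x ω n ⬝ᵥ θs) (response x ε θs ω n) ∂μ ≤
      ∫ ω, sqLoss (design x ω n ⬝ᵥ θ) (response x ε θs ω n) ∂μ

/-! ### The explicit quantities in the bounds -/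

/-- `N - 3 cx² √N (√k + 5)`. -/
def MJden (cx : ℝ) (N k : ℕ) : ℝ := N - 3 * cx ^ 2 * √N * (√k + 5)

/-- The scalar `M_J`; here `k` is the size of the true support. -/
def MJ (C cx : ℝ) (N D k : ℕ) : ℝ :=
  C * k * (√(50 * cx ^ 2) + √(2 * cx ^ 2 * Real.log (N * ((D : ℝ) - k))))
      * (√k + √(50 * cx ^ 4) + √(2 * cx ^ 4 * Real.log N)) / MJden cx N k
  + C * k * (k + k * cx ^ 2 * (Real.log N + 26))
      * (√N + √(50 * cx ^ 4) + √(2 * cx ^ 4 * Real.log ((D : ℝ) - k)))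
      * (√((N : ℝ) * k) + √(50 * cx ^ 4)) / MJden cx N k ^ 2

/-- The lower bound required of the regularization parameter. -/
def lamBound (C C' α cx ce : ℝ) (N D k : ℕ) : ℝ :=
  1 / (α - MJ C cx N D k)
      * √(cx ^ 2 * ce ^ 2 * Real.log D / (N * C') + 25 * cx ^ 2 * ce ^ 2 / (N * C'))
  + 4 * cx * ce * (Real.log ((N : ℝ) * D) + 26) / (N * (α - MJ C cx N D k))

/-- The strong convexity constant `1 - 3 C cx² (√k + 5) / √N`. -/
def Lmin (C cx : ℝ) (N k : ℕ) : ℝ := 1 - 3 * C * cx ^ 2 * (√k + 5) / √N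

/-- The constant `T_min = (γ + 4) / L_min` of the beta-min condition, with `γ = α - M_J`. -/
def Tmin (C α cx : ℝ) (N D k : ℕ) : ℝ := (α - MJ C cx N D k + 4) / Lmin C cx N k

end

end SparseLOO

/-!
On one event of high probability the full-data problem and all the leave-one-out problems can be
analysed at once, and the analysis there is deterministic (`supportStable_of_bounds`). Write `H` for
the Gram matrix, `M = H_{SS}`, and `w = (1/N) ∑ ε_m x_m`. The vector `θ* + δ` with
`δ_S = M⁻¹ (w_S - λ sign θ*_S)` and `δ = 0` off `S` satisfies the stationarity equations on `S` as
soon as `|δ_s| < |θ*_s|`, which the beta-min condition gives once `M` is coercive. Off `S` its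
gradient is `J (w_S - λ sign θ*_S) - w` with `J = H_{SᶜS} M⁻¹`, so incoherence makes it smaller
than `λ` if `w` is small relative to `α λ`; then `θ* + δ` is the unique solution
(`exists_solution_of_incoherence`).

Leaving out the point `n` moves `w` by `ε_n x_n / N`, moves `M` by the rank-one matrix
`u uᵀ / N` with `u = (x_n)_S`, and moves the row `J_d` by the vector
`((J_d u - x_{nd}) / N) M_n⁻¹ u`, where `M_n` is the new block (`incoherence_erase`). All three
perturbations are small when the covariates are bounded by a multiple of `√(log (N D))`, and by a
multiple of `√(log (N |S|))` on `S`. The same bounds show that the corrections in the two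
approximations are below the gap left by the beta-min condition (`supp_restrictedStep`).

The event has high probability for elementary reasons. A Chebyshev bound on the Frobenius norm of
`M - 1` suffices for coercivity, because `|S|² = o(N)`. The noise is uncorrelated with the
covariates since `θ*` minimizes the population loss, and `ε_n x_{nd}` is sub-exponential whatever
the dependence of the two factors, so that `w` is controlled by Bernstein's inequality, in its
sub-Gaussian regime because `log D ≤ N` (`LinearModel.exists_good_event`). The explicit `M_J` is
needed only through `M_J → 0`, so the constants `C = 1` and `C' = 10⁻⁴` leave ample room.
-/

namespace SparseLOO

/-! ### Matrices with a coercive quadratic form -/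

section Coercive

variable {ι : Type*} [Fintype ι]

theorem dotProduct_self_nonneg (v : ι → ℝ) : 0 ≤ v ⬝ᵥ v :=
  Finset.sum_nonneg fun _ _ => mul_self_nonneg _

theorem abs_dotProduct_le_sum_mul {v w : ι → ℝ} {b : ℝ} (hw : ∀ i, |w i| ≤ b) :
    |v ⬝ᵥ w| ≤ (∑ i, |v i|) * b := by
  rw [dotProduct, Finset.sum_mul]
  refine (Finset.abs_sum_le_sum_abs _ _).trans (Finset.sum_le_sum fun i _ => ?_)
  rw [abs_mul]
  exact mul_le_mul_of_nonneg_left (hw i) (abs_nonneg _)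

theorem sq_sum_abs_le_card_mul (v : ι → ℝ) :
    (∑ i, |v i|) ^ 2 ≤ Fintype.card ι * (v ⬝ᵥ v) := by
  have h := sq_sum_le_card_mul_sum_sq (s := (Finset.univ : Finset ι)) (f := fun i => |v i|)
  simpa [dotProduct, sq, Finset.card_univ] using h

variable [DecidableEq ι] {M : Matrix ι ι ℝ} {c : ℝ}

theorem isUnit_det_of_coercive (hc : 0 < c) (hM : ∀ v : ι → ℝ, c * (v ⬝ᵥ v) ≤ v ⬝ᵥ (M *ᵥ v)) :
    IsUnit M.det := by
  rw [← Matrix.isUnit_iff_isUnit_det, ← Matrix.mulVec_injective_iff_isUnit]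
  have key : ∀ v, M *ᵥ v = 0 → v = 0 := by
    intro v hv
    have h1 := hM v
    rw [hv, dotProduct_zero] at h1
    have h2 : 0 ≤ v ⬝ᵥ v := dotProduct_self_nonneg v
    have h3 : v ⬝ᵥ v = 0 := by nlinarith
    exact dotProduct_self_eq_zero.mp h3
  intro v w hvw
  have := key (v - w) (by rw [mulVec_sub, sub_eq_zero]; exact hvw)
  exact sub_eq_zero.mp this

/-- The `ℓ₁` bound for the solution of a coercive system with an `ℓ_∞`-bounded right-hand side,
which comes from comparing both norms with the Euclidean one. -/
theorem sum_abs_inv_mulVec_le (hc : 0 < c)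
    (hM : ∀ v : ι → ℝ, c * (v ⬝ᵥ v) ≤ v ⬝ᵥ (M *ᵥ v)) {a : ι → ℝ} {b : ℝ} (hb : 0 ≤ b)
    (ha : ∀ i, |a i| ≤ b) : ∑ i, |(M⁻¹ *ᵥ a) i| ≤ Fintype.card ι * b / c := by
  set v := M⁻¹ *ᵥ a with hv
  have hMv : M *ᵥ v = a := by
    rw [hv, mulVec_mulVec, Matrix.mul_nonsing_inv _ (isUnit_det_of_coercive hc hM), one_mulVec]
  have h1 := hM v
  rw [hMv] at h1
  have h2 := (le_abs_self _).trans (abs_dotProduct_le_sum_mul (v := v) ha)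
  have h3 := sq_sum_abs_le_card_mul v
  set T := ∑ i, |v i|
  have hT : 0 ≤ T := Finset.sum_nonneg fun i _ => abs_nonneg _
  rw [le_div_iff₀ hc]
  rcases hT.eq_or_lt with h0 | h0
  · rw [← h0, zero_mul]; positivity
  · have hk : (0 : ℝ) ≤ Fintype.card ι := Nat.cast_nonneg _
    have h4 : T * (T * c) ≤ T * (Fintype.card ι * b) := by
      calc T * (T * c) = c * T ^ 2 := by ring
        _ ≤ c * (Fintype.card ι * (v ⬝ᵥ v)) := mul_le_mul_of_nonneg_left h3 hc.le
        _ = Fintype.card ι * (c * (v ⬝ᵥ v)) := by ring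
        _ ≤ Fintype.card ι * (T * b) := mul_le_mul_of_nonneg_left (h1.trans h2) hk
        _ = _ := by ring
    exact le_of_mul_le_mul_left h4 h0

/-- The coordinatewise bound gains a factor `√|ι|` over the `ℓ₁` bound. -/
theorem abs_inv_mulVec_le (hc : 0 < c)
    (hM : ∀ v : ι → ℝ, c * (v ⬝ᵥ v) ≤ v ⬝ᵥ (M *ᵥ v)) {a : ι → ℝ} {b : ℝ} (hb : 0 ≤ b)
    (ha : ∀ i, |a i| ≤ b) (i : ι) : |(M⁻¹ *ᵥ a) i| ≤ √(Fintype.card ι) * b / c := by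
  set v := M⁻¹ *ᵥ a with hv
  have hMv : M *ᵥ v = a := by
    rw [hv, mulVec_mulVec, Matrix.mul_nonsing_inv _ (isUnit_det_of_coercive hc hM), one_mulVec]
  have h1 := hM v
  rw [hMv] at h1
  have h2 := (le_abs_self _).trans (abs_dotProduct_le_sum_mul (v := v) ha)
  have h3 := sum_abs_inv_mulVec_le hc hM hb ha
  rw [← hv] at h3
  have h4 : v i ^ 2 ≤ v ⬝ᵥ v := by
    rw [dotProduct, sq]
    exact Finset.single_le_sum (f := fun i => v i * v i) (fun j _ => mul_self_nonneg _)
      (Finset.mem_univ i)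
  have hk : (0 : ℝ) ≤ Fintype.card ι := Nat.cast_nonneg _
  apply abs_le_of_sq_le_sq _ (by positivity)
  rw [div_pow, mul_pow, Real.sq_sqrt hk, le_div_iff₀ (by positivity)]
  rw [le_div_iff₀ hc] at h3
  calc v i ^ 2 * c ^ 2 ≤ (v ⬝ᵥ v) * c ^ 2 := mul_le_mul_of_nonneg_right h4 (by positivity)
    _ = c * (c * (v ⬝ᵥ v)) := by ring
    _ ≤ c * ((∑ i, |v i|) * b) := mul_le_mul_of_nonneg_left (h1.trans h2) hc.le
    _ = (∑ i, |v i|) * c * b := by ring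
    _ ≤ Fintype.card ι * b * b := mul_le_mul_of_nonneg_right h3 hb
    _ = _ := by ring

/-- A matrix at Frobenius distance at most `r` from the identity is coercive with constant
`1 - r`. -/
theorem coercive_of_frobenius_le {r : ℝ} (hr : 0 ≤ r)
    (hM : ∑ i, ∑ j, (M i j - (1 : Matrix ι ι ℝ) i j) ^ 2 ≤ r ^ 2) (v : ι → ℝ) :
    (1 - r) * (v ⬝ᵥ v) ≤ v ⬝ᵥ (M *ᵥ v) := by
  set E := M - 1 with hE
  have hME : v ⬝ᵥ (M *ᵥ v) = v ⬝ᵥ v + v ⬝ᵥ (E *ᵥ v) := by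
    rw [hE, sub_mulVec, one_mulVec, dotProduct_sub]; ring
  have hvv : 0 ≤ v ⬝ᵥ v := dotProduct_self_nonneg v
  have h1 : (v ⬝ᵥ (E *ᵥ v)) ^ 2 ≤ (v ⬝ᵥ v) * ((E *ᵥ v) ⬝ᵥ (E *ᵥ v)) := by
    have := Finset.sum_mul_sq_le_sq_mul_sq Finset.univ v (E *ᵥ v)
    simpa [dotProduct, sq] using this
  have h2 : (E *ᵥ v) ⬝ᵥ (E *ᵥ v) ≤ r ^ 2 * (v ⬝ᵥ v) := by
    have h3 : ∀ i, (E *ᵥ v) i * (E *ᵥ v) i ≤ (∑ j, E i j ^ 2) * (v ⬝ᵥ v) := by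
      intro i
      have := Finset.sum_mul_sq_le_sq_mul_sq Finset.univ (E i) v
      simpa [mulVec, dotProduct, sq] using this
    calc (E *ᵥ v) ⬝ᵥ (E *ᵥ v) ≤ ∑ i, (∑ j, E i j ^ 2) * (v ⬝ᵥ v) :=
          Finset.sum_le_sum fun i _ => h3 i
      _ = (∑ i, ∑ j, E i j ^ 2) * (v ⬝ᵥ v) := by rw [Finset.sum_mul]
      _ ≤ _ := mul_le_mul_of_nonneg_right (by simpa [hE] using hM) hvv
  have h4 : |v ⬝ᵥ (E *ᵥ v)| ≤ r * (v ⬝ᵥ v) := by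
    apply abs_le_of_sq_le_sq _ (by positivity)
    calc _ ≤ _ := h1
      _ ≤ (v ⬝ᵥ v) * (r ^ 2 * (v ⬝ᵥ v)) := mul_le_mul_of_nonneg_left h2 hvv
      _ = _ := by ring
  have := (abs_le.mp h4).1
  rw [hME]; linarith

end Coercive

/-! ### Optimality conditions for the `ℓ₁`-regularized problem -/

section Lasso

variable {N D : ℕ}

/-- The Gram matrix `(1/N) ∑_{m ∈ A} x_m x_mᵀ` of the data points in `A`. -/
noncomputable def gram (X : Matrix (Fin N) (Fin D) ℝ) (A : Finset (Fin N)) :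
    Matrix (Fin D) (Fin D) ℝ :=
  (1 / (N : ℝ)) • ∑ m ∈ A, hessLoss (X m)

theorem gram_apply (X : Matrix (Fin N) (Fin D) ℝ) (A : Finset (Fin N)) (i j : Fin D) :
    gram X A i j = (1 / (N : ℝ)) * ∑ m ∈ A, X m i * X m j := by
  simp [gram, hessLoss, Matrix.sum_apply, vecMulVec_apply]

theorem gram_comm (X : Matrix (Fin N) (Fin D) ℝ) (A : Finset (Fin N)) (i j : Fin D) :
    gram X A i j = gram X A j i := by
  simp only [gram_apply, mul_comm]

theorem hess_eq_gram (X : Matrix (Fin N) (Fin D) ℝ) : hess X = gram X Finset.univ := rfl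

theorem hessMinus_eq_gram (X : Matrix (Fin N) (Fin D) ℝ) (n : Fin N) :
    hessMinus X n = gram X (Finset.univ.erase n) := by
  rw [hessMinus, hess, gram, ← smul_sub, sub_eq_iff_eq_add.mpr
    (Finset.sum_erase_add _ _ (Finset.mem_univ n)).symm]

/-- The gradient at `θs + δ` of the loss of the data in `A`, for the responses
`y_m = x_mᵀ θs + ε_m`, is `M δ - w`, with `M` the Gram matrix and `w` the correlation of the noise
with the covariates. -/
theorem grad_empLoss_eq (X : Matrix (Fin N) (Fin D) ℝ) (A : Finset (Fin N)) (ε : Fin N → ℝ)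
    (θs δ : Fin D → ℝ) (d : Fin D) :
    (1 / (N : ℝ)) * ∑ m ∈ A, (X m ⬝ᵥ (θs + δ) - (X m ⬝ᵥ θs + ε m)) * X m d
      = (gram X A *ᵥ δ) d - (1 / (N : ℝ)) * ∑ m ∈ A, ε m * X m d := by
  have h : (gram X A *ᵥ δ) d = (1 / (N : ℝ)) * ∑ m ∈ A, (X m ⬝ᵥ δ) * X m d := by
    simp only [mulVec, dotProduct, gram_apply, Finset.sum_mul, mul_assoc, ← Finset.mul_sum]
    rw [Finset.sum_comm]
    congr 1
    exact Finset.sum_congr rfl fun m _ => Finset.sum_congr rfl fun j _ => by ring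
  rw [h, ← mul_sub, ← Finset.sum_sub_distrib]
  congr 1
  refine Finset.sum_congr rfl fun m _ => ?_
  rw [dotProduct_add]; ring

/-- The second-order Taylor expansion of the loss is exact. -/
theorem empLoss_add (X : Matrix (Fin N) (Fin D) ℝ) (y : Fin N → ℝ) (A : Finset (Fin N))
    (θ v : Fin D → ℝ) :
    empLoss X y A (θ + v) = empLoss X y A θ
      + ∑ d, ((1 / (N : ℝ)) * ∑ m ∈ A, (X m ⬝ᵥ θ - y m) * X m d) * v d
      + (v ⬝ᵥ (gram X A *ᵥ v)) / 2 := by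
  have h1 : v ⬝ᵥ (gram X A *ᵥ v) = (1 / (N : ℝ)) * ∑ m ∈ A, (X m ⬝ᵥ v) ^ 2 := by
    simp only [gram, smul_mulVec, sum_mulVec, dotProduct_smul, dotProduct_sum, smul_eq_mul,
      hessLoss, vecMulVec_mulVec]
    congr 1
    refine Finset.sum_congr rfl fun m _ => ?_
    simp [dotProduct_comm v, sq]
  have h2 : ∑ d, ((1 / (N : ℝ)) * ∑ m ∈ A, (X m ⬝ᵥ θ - y m) * X m d) * v d
      = (1 / (N : ℝ)) * ∑ m ∈ A, (X m ⬝ᵥ θ - y m) * (X m ⬝ᵥ v) := by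
    simp only [mul_assoc, ← Finset.mul_sum, Finset.sum_mul]
    rw [Finset.sum_comm]
    congr 1
    refine Finset.sum_congr rfl fun m _ => ?_
    simp only [dotProduct, Finset.mul_sum]
  rw [h1, h2, empLoss, empLoss, ← mul_add, mul_div_assoc, ← mul_add]
  congr 1
  rw [Finset.sum_div, ← Finset.sum_add_distrib, ← Finset.sum_add_distrib]
  refine Finset.sum_congr rfl fun m _ => ?_
  rw [sqLoss, sqLoss, dotProduct_add]; ring

/-- Summing over all coordinates a function that vanishes off `S`. -/
theorem sum_eq_sum_subtype {S : Finset (Fin D)} {f : Fin D → ℝ} (hf : ∀ d ∉ S, f d = 0) :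
    ∑ d, f d = ∑ s : S, f s := by
  rw [← Finset.sum_subset (Finset.subset_univ S) (fun d _ hd => hf d hd)]
  exact (Finset.sum_coe_sort S f).symm

theorem dotProduct_mulVec_eq_blockSS {S : Finset (Fin D)} (M : Matrix (Fin D) (Fin D) ℝ)
    {v : Fin D → ℝ} (hv : ∀ d ∉ S, v d = 0) :
    v ⬝ᵥ (M *ᵥ v) = (fun s : S => v s) ⬝ᵥ (blockSS M S *ᵥ fun s : S => v s) := by
  rw [dotProduct, sum_eq_sum_subtype (S := S) (fun d hd => by rw [hv d hd, zero_mul])]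
  refine Finset.sum_congr rfl fun s _ => ?_
  congr 1
  rw [mulVec, dotProduct, sum_eq_sum_subtype (S := S) (fun d hd => by rw [hv d hd, mul_zero])]
  rfl

/-- A point satisfying the stationarity conditions strictly off its support `S`, where the loss is
strongly convex along `S`, is the only solution. -/
theorem unique_solution_of_strict_stationarity (X : Matrix (Fin N) (Fin D) ℝ) (y : Fin N → ℝ)
    {lam c : ℝ} (A : Finset (Fin N)) (S : Finset (Fin D)) (θ : Fin D → ℝ) (hlam : 0 < lam)
    (hc : 0 < c)
    (hM : ∀ v : S → ℝ, c * (v ⬝ᵥ v) ≤ v ⬝ᵥ (blockSS (gram X A) S *ᵥ v))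
    (hpsd : ∀ v, 0 ≤ v ⬝ᵥ (gram X A *ᵥ v))
    (hS : ∀ d ∈ S, (1 / (N : ℝ)) * ∑ m ∈ A, (X m ⬝ᵥ θ - y m) * X m d
      = -(lam * SignType.sign (θ d)))
    (hSc : ∀ d ∉ S, θ d = 0 ∧ |(1 / (N : ℝ)) * ∑ m ∈ A, (X m ⬝ᵥ θ - y m) * X m d| < lam) :
    IsSolution X y lam A θ ∧ ∀ θ', IsSolution X y lam A θ' → θ' = θ := by
  set G : Fin D → ℝ := fun d => (1 / (N : ℝ)) * ∑ m ∈ A, (X m ⬝ᵥ θ - y m) * X m d with hG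
  -- the excess of the objective at `θ'`, coordinate by coordinate
  have hterm : ∀ θ' : Fin D → ℝ, ∀ d, 0 ≤ G d * (θ' d - θ d) + lam * (|θ' d| - |θ d|) ∧
      (d ∉ S → θ' d ≠ 0 → 0 < G d * (θ' d - θ d) + lam * (|θ' d| - |θ d|)) := by
    intro θ' d
    by_cases hd : d ∈ S
    · refine ⟨?_, fun h => absurd hd h⟩
      have h1 : G d = -(lam * SignType.sign (θ d)) := hS d hd
      have h2 : (SignType.sign (θ d) : ℝ) * θ' d ≤ |θ' d| := by
        rcases lt_trichotomy (θ d) 0 with h | h | h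
        · simp [sign_neg h, neg_le_abs]
        · simp [h]
        · simp [sign_pos h, le_abs_self]
      have h3 : (SignType.sign (θ d) : ℝ) * θ d = |θ d| := sign_mul_self _
      rw [h1]
      nlinarith
    · obtain ⟨h0, h1⟩ := hSc d hd
      have h1 : |G d| < lam := h1
      have h2 : -(|G d| * |θ' d|) ≤ G d * θ' d := by
        rw [← abs_mul]; exact neg_abs_le _
      rw [h0, sub_zero, abs_zero, sub_zero]
      refine ⟨by nlinarith [abs_nonneg (θ' d)], fun _ h => ?_⟩
      have : 0 < |θ' d| := abs_pos.mpr h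
      nlinarith
  have hobj : ∀ θ' : Fin D → ℝ, empLoss X y A θ' + lam * ∑ d, |θ' d|
      = empLoss X y A θ + lam * ∑ d, |θ d|
        + ∑ d, (G d * (θ' d - θ d) + lam * (|θ' d| - |θ d|))
        + ((θ' - θ) ⬝ᵥ (gram X A *ᵥ (θ' - θ))) / 2 := by
    intro θ'
    have := empLoss_add X y A θ (θ' - θ)
    rw [add_sub_cancel] at this
    rw [this, Finset.sum_add_distrib, ← Finset.mul_sum, Finset.sum_sub_distrib]
    simp only [hG, Pi.sub_apply]
    ring
  have hsum : ∀ θ' : Fin D → ℝ, 0 ≤ ∑ d, (G d * (θ' d - θ d) + lam * (|θ' d| - |θ d|)) :=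
    fun θ' => Finset.sum_nonneg fun d _ => (hterm θ' d).1
  refine ⟨fun θ' => ?_, fun θ' h' => ?_⟩
  · rw [hobj θ']
    linarith [hsum θ', hpsd (θ' - θ)]
  · have h1 := h' θ
    rw [hobj θ'] at h1
    have h2 : ∑ d, (G d * (θ' d - θ d) + lam * (|θ' d| - |θ d|)) = 0 := by
      linarith [hsum θ', hpsd (θ' - θ)]
    have h3 : (θ' - θ) ⬝ᵥ (gram X A *ᵥ (θ' - θ)) ≤ 0 := by
      linarith [hsum θ', hpsd (θ' - θ)]
    have h4 : ∀ d ∉ S, (θ' - θ) d = 0 := by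
      intro d hd
      by_contra hne
      rw [Pi.sub_apply, (hSc d hd).1, sub_zero] at hne
      have := (Finset.sum_eq_zero_iff_of_nonneg (fun d _ => (hterm θ' d).1)).mp h2 d
        (Finset.mem_univ d)
      exact absurd this ((hterm θ' d).2 hd hne).ne'
    rw [dotProduct_mulVec_eq_blockSS _ h4] at h3
    have h5 := (hM _).trans h3
    have h6 : (fun s : S => (θ' - θ) s) = 0 := by
      rw [← dotProduct_self_eq_zero]
      have := dotProduct_self_nonneg (fun s : S => (θ' - θ) s)
      nlinarith
    funext d
    rw [← sub_eq_zero]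
    by_cases hd : d ∈ S
    · exact congrFun h6 ⟨d, hd⟩
    · exact h4 d hd

theorem gram_psd (X : Matrix (Fin N) (Fin D) ℝ) (A : Finset (Fin N)) (v : Fin D → ℝ) :
    0 ≤ v ⬝ᵥ (gram X A *ᵥ v) := by
  simp only [gram, smul_mulVec, sum_mulVec, dotProduct_smul, dotProduct_sum, smul_eq_mul,
    hessLoss, vecMulVec_mulVec]
  refine mul_nonneg (by positivity) (Finset.sum_nonneg fun m _ => ?_)
  simpa [dotProduct_comm v] using mul_self_nonneg (X m ⬝ᵥ v)

end Lasso

/-! ### Support recovery from a primal-dual certificate -/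

section Recovery

variable {N D : ℕ}

theorem supp_add_eq {S : Finset (Fin D)} {θs δ : Fin D → ℝ} (hS : supp θs = S)
    (h0 : ∀ d ∉ S, δ d = 0) (h1 : ∀ d ∈ S, |δ d| < |θs d|) : supp (θs + δ) = S := by
  ext d
  simp only [supp, Finset.mem_filter, Finset.mem_univ, true_and, Pi.add_apply]
  constructor
  · intro h
    by_contra hd
    refine h ?_
    have : θs d = 0 := by
      by_contra h'
      exact hd (hS ▸ by simp [supp, h'])
    rw [this, h0 d hd, add_zero]
  · intro hd h
    have := h1 d hd
    rw [eq_neg_of_add_eq_zero_left h, abs_neg] at this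
    exact lt_irrefl _ this

theorem sign_add_eq {a b : ℝ} (h : |b| < |a|) : SignType.sign (a + b) = SignType.sign a := by
  rcases lt_trichotomy a 0 with ha | ha | ha
  · rw [abs_of_neg ha] at h
    rw [sign_neg ha, sign_neg (by linarith [(abs_lt.mp h).2])]
  · rw [ha, abs_zero] at h
    exact absurd h (abs_nonneg b).not_gt
  · rw [abs_of_pos ha] at h
    rw [sign_pos ha, sign_pos (by linarith [(abs_lt.mp h).1])]

/-- The primal-dual witness argument. The candidate `θs + δ` solves the stationarity equation on
`S` with the signs of `θs`. The row `J` expresses the Gram row of an inactive coordinate through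
the rows in `S`, so that the gradient off `S` is `J (w_S - lam sign) - w`, and a bound on the
`ℓ₁` norm of `J` yields strict dual feasibility. -/
theorem exists_solution_of_incoherence (X : Matrix (Fin N) (Fin D) ℝ) (ε : Fin N → ℝ)
    (θs : Fin D → ℝ) {lam c g β : ℝ} (A : Finset (Fin N)) (S : Finset (Fin D))
    (hS : supp θs = S) (hlam : 0 < lam) (hc : 0 < c) (hg : 0 ≤ g) (hgβ : (2 - β) * g < β * lam)
    (hM : ∀ v : S → ℝ, c * (v ⬝ᵥ v) ≤ v ⬝ᵥ (blockSS (gram X A) S *ᵥ v))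
    (hJ : ∀ d ∉ S, ∃ J : S → ℝ,
      (∀ s : S, gram X A d s = ∑ t : S, J t * gram X A t s) ∧ ∑ t, |J t| ≤ 1 - β)
    (hw : ∀ d, |(1 / (N : ℝ)) * ∑ m ∈ A, ε m * X m d| ≤ g)
    (hθs : ∀ s ∈ S, √(S.card) * (g + lam) / c < |θs s|) :
    ∃ δ : Fin D → ℝ, (∀ d ∉ S, δ d = 0) ∧ (∀ d, |δ d| ≤ √(S.card) * (g + lam) / c) ∧
      ∑ d, |δ d| ≤ S.card * (g + lam) / c ∧ supp (θs + δ) = S ∧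
      IsSolution X (fun m => X m ⬝ᵥ θs + ε m) lam A (θs + δ) ∧
      ∀ θ', IsSolution X (fun m => X m ⬝ᵥ θs + ε m) lam A θ' → θ' = θs + δ := by
  set w : Fin D → ℝ := fun d => (1 / (N : ℝ)) * ∑ m ∈ A, ε m * X m d with hwdef
  set a : S → ℝ := fun s => w s - lam * SignType.sign (θs s) with ha
  have hsign : ∀ t : ℝ, |((SignType.sign t : SignType) : ℝ)| ≤ 1 := by
    intro t
    rcases lt_trichotomy t 0 with h | h | h
    · simp [sign_neg h]
    · simp [h]
    · simp [sign_pos h]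
  have hgl : 0 ≤ g + lam := by linarith
  have hab : ∀ s, |a s| ≤ g + lam := by
    intro s
    refine (abs_sub _ _).trans (add_le_add (hw s) ?_)
    rw [abs_mul, abs_of_pos hlam]
    nlinarith [hsign (θs s)]
  set v := (blockSS (gram X A) S)⁻¹ *ᵥ a with hv
  have hMv : blockSS (gram X A) S *ᵥ v = a := by
    rw [hv, mulVec_mulVec, Matrix.mul_nonsing_inv _ (isUnit_det_of_coercive hc hM), one_mulVec]
  set δ : Fin D → ℝ := fun d => if h : d ∈ S then v ⟨d, h⟩ else 0 with hδ
  have hδ0 : ∀ d ∉ S, δ d = 0 := fun d hd => by simp [hδ, hd]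
  have hδS : ∀ s : S, δ s = v s := fun s => by simp [hδ]
  have hcard : (Fintype.card S : ℝ) = S.card := by rw [Fintype.card_coe]
  have hδb : ∀ d, |δ d| ≤ √(S.card) * (g + lam) / c := by
    intro d
    by_cases hd : d ∈ S
    · have := abs_inv_mulVec_le hc hM hgl hab ⟨d, hd⟩
      rw [hcard] at this
      rw [hδS ⟨d, hd⟩]
      exact this
    · rw [hδ0 d hd, abs_zero]; positivity
  have hδ1 : ∑ d, |δ d| ≤ S.card * (g + lam) / c := by
    rw [sum_eq_sum_subtype (S := S) (fun d hd => by rw [hδ0 d hd, abs_zero])]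
    simp only [hδS]
    have := sum_abs_inv_mulVec_le hc hM hgl hab
    rwa [hcard] at this
  have hlt : ∀ d ∈ S, |δ d| < |θs d| := fun d hd => (hδb d).trans_lt (hθs d hd)
  have hMδ : ∀ d, (gram X A *ᵥ δ) d = ∑ s : S, gram X A d s * v s := by
    intro d
    rw [mulVec, dotProduct, sum_eq_sum_subtype (S := S) (fun j hj => by rw [hδ0 j hj, mul_zero])]
    simp only [hδS]
  have hMδS : ∀ s : S, (gram X A *ᵥ δ) s = a s := by
    intro s
    rw [hMδ, ← hMv]; rfl
  refine ⟨δ, hδ0, hδb, hδ1, supp_add_eq hS hδ0 hlt, ?_⟩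
  refine unique_solution_of_strict_stationarity X _ A S (θs + δ) hlam hc hM (gram_psd X A) ?_ ?_
  · intro d hd
    rw [grad_empLoss_eq, hMδS ⟨d, hd⟩, Pi.add_apply, sign_add_eq (hlt d hd)]
    simp only [ha, hwdef]
    ring
  · intro d hd
    have hθ0 : θs d = 0 := by
      by_contra h'
      exact hd (hS ▸ by simp [supp, h'])
    refine ⟨by rw [Pi.add_apply, hθ0, hδ0 d hd, add_zero], ?_⟩
    rw [grad_empLoss_eq]
    obtain ⟨J, hJ1, hJ2⟩ := hJ d hd
    have h1 : (gram X A *ᵥ δ) d = J ⬝ᵥ a := by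
      rw [hMδ, ← hMv, dotProduct_mulVec, dotProduct]
      refine Finset.sum_congr rfl fun s _ => ?_
      rw [hJ1 s]; rfl
    rw [h1]
    calc |J ⬝ᵥ a - w d| ≤ |J ⬝ᵥ a| + |w d| := abs_sub _ _
      _ ≤ (1 - β) * (g + lam) + g :=
        add_le_add ((abs_dotProduct_le_sum_mul hab).trans
          (mul_le_mul_of_nonneg_right hJ2 hgl)) (hw d)
      _ < lam := by linarith

theorem gram_erase_apply (X : Matrix (Fin N) (Fin D) ℝ) (n : Fin N) (i j : Fin D) :
    gram X (Finset.univ.erase n) i j = gram X Finset.univ i j - X n i * X n j / N := by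
  rw [gram_apply, gram_apply, ← Finset.sum_erase_add _ _ (Finset.mem_univ n)]
  ring

/-- Deleting a data point `n` changes the row `J` that expresses a Gram row through the rows in
`S` by a multiple of `M'⁻¹ u`, where `M'` is the Gram block of the remaining points and `u` the
restriction of `x_n` to `S`. -/
theorem incoherence_erase (X : Matrix (Fin N) (Fin D) ℝ) (S : Finset (Fin D)) (n : Fin N)
    {c b B a : ℝ} (hc : 0 < c) (hb0 : 0 ≤ b)
    (hM : ∀ v : S → ℝ, c * (v ⬝ᵥ v) ≤
      v ⬝ᵥ (blockSS (gram X (Finset.univ.erase n)) S *ᵥ v))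
    (hb : ∀ s ∈ S, |X n s| ≤ b) {d : Fin D} (hB : |X n d| ≤ B) {J : S → ℝ} (ha : a ≤ 1)
    (hJ : ∀ s : S, gram X Finset.univ d s = ∑ t : S, J t * gram X Finset.univ t s)
    (hJa : ∑ t, |J t| ≤ a) :
    ∃ J' : S → ℝ, (∀ s : S, gram X (Finset.univ.erase n) d s
        = ∑ t : S, J' t * gram X (Finset.univ.erase n) t s) ∧
      ∑ t, |J' t| ≤ a + (b + B) / N * (S.card * b / c) := by
  set u : S → ℝ := fun s => X n s with hu
  have hub : ∀ s, |u s| ≤ b := fun s => hb s s.2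
  set v := (blockSS (gram X (Finset.univ.erase n)) S)⁻¹ *ᵥ u with hv
  have hMv : blockSS (gram X (Finset.univ.erase n)) S *ᵥ v = u := by
    rw [hv, mulVec_mulVec, Matrix.mul_nonsing_inv _ (isUnit_det_of_coercive hc hM), one_mulVec]
  set κ := (J ⬝ᵥ u - X n d) / N with hκ
  refine ⟨fun t => J t + κ * v t, fun s => ?_, ?_⟩
  · have h1 : ∑ t : S, v t * gram X (Finset.univ.erase n) t s = X n s := by
      have := congrFun hMv s
      rw [mulVec, dotProduct] at this
      rw [← show u s = X n s from rfl, ← this]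
      refine Finset.sum_congr rfl fun t _ => ?_
      rw [mul_comm, gram_comm]; rfl
    have h2 : ∑ t : S, J t * gram X (Finset.univ.erase n) t s
        = gram X Finset.univ d s - (J ⬝ᵥ u) * X n s / N := by
      rw [hJ s, dotProduct, Finset.sum_mul, Finset.sum_div, ← Finset.sum_sub_distrib]
      refine Finset.sum_congr rfl fun t _ => ?_
      rw [gram_erase_apply]
      simp only [hu]
      ring
    simp only [add_mul, Finset.sum_add_distrib, mul_assoc, ← Finset.mul_sum]
    rw [h1, h2, gram_erase_apply, hκ]
    ring
  · have h1 : |J ⬝ᵥ u| ≤ b := (abs_dotProduct_le_sum_mul hub).trans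
      (by nlinarith)
    have h2 : |κ| ≤ (b + B) / N := by
      rw [hκ, abs_div, Nat.abs_cast]
      exact div_le_div_of_nonneg_right ((abs_sub _ _).trans (add_le_add h1 hB)) (Nat.cast_nonneg _)
    have h3 := sum_abs_inv_mulVec_le hc hM hb0 hub
    rw [← hv, Fintype.card_coe] at h3
    calc ∑ t, |J t + κ * v t| ≤ ∑ t, (|J t| + |κ| * |v t|) :=
          Finset.sum_le_sum fun t _ => (abs_add_le _ _).trans (by rw [abs_mul])
      _ = ∑ t, |J t| + |κ| * ∑ t, |v t| := by rw [Finset.sum_add_distrib, Finset.mul_sum]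
      _ ≤ _ := add_le_add hJa (mul_le_mul h2 h3 (Finset.sum_nonneg fun t _ => abs_nonneg _)
          ((abs_nonneg _).trans h2))

/-- Both approximations keep the support `S` of `θs + δ` when the correction
`(1/N) A_{SS}⁻¹ g_S` is small relative to the nonzero entries of `θs`. -/
theorem supp_restrictedStep (M : Matrix (Fin D) (Fin D) ℝ) (S : Finset (Fin D))
    (x θs δ : Fin D → ℝ) {c b e τ r ε₀ : ℝ} (hN : 0 < N) (hc : 0 < c) (hb0 : 0 ≤ b)
    (he0 : 0 ≤ e) (hS : supp θs = S)
    (hM : ∀ v : S → ℝ, c * (v ⬝ᵥ v) ≤ v ⬝ᵥ (blockSS M S *ᵥ v))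
    (hδ0 : ∀ d ∉ S, δ d = 0) (hδr : ∀ d, |δ d| ≤ r) (hδ1 : ∑ d, |δ d| ≤ τ)
    (hsupp : supp (θs + δ) = S)
    (hb : ∀ s ∈ S, |x s| ≤ b) (he : ∀ s ∈ S, |ε₀ * x s| ≤ N * e)
    (hθs : ∀ s ∈ S, r + √(S.card) * (b ^ 2 * τ / N + e) / c < |θs s|) :
    supp (restrictedStep N M (gradLoss x (x ⬝ᵥ θs + ε₀) (θs + δ)) (θs + δ)) = S := by
  have hN' : (0 : ℝ) < N := Nat.cast_pos.mpr hN
  have hτ : 0 ≤ τ := (Finset.sum_nonneg fun d _ => abs_nonneg _).trans hδ1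
  set G : Fin D → ℝ := gradLoss x (x ⬝ᵥ θs + ε₀) (θs + δ) with hG
  have hGs : ∀ s : S, |G s| ≤ b ^ 2 * τ + N * e := by
    intro s
    have h1 : G s = (x ⬝ᵥ δ) * x s - ε₀ * x s := by
      simp only [hG, gradLoss, dotProduct_add, Pi.smul_apply, smul_eq_mul]; ring
    have h2 : |x ⬝ᵥ δ| ≤ τ * b := by
      rw [dotProduct, sum_eq_sum_subtype (S := S) (fun d hd => by rw [hδ0 d hd, mul_zero])]
      have h3 : |(fun s : S => δ s) ⬝ᵥ (fun s : S => x s)| ≤ (∑ s : S, |δ s|) * b :=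
        abs_dotProduct_le_sum_mul (fun s : S => hb s s.2)
      rw [← sum_eq_sum_subtype (S := S) (f := fun d => |δ d|)
        (fun d hd => by rw [hδ0 d hd, abs_zero])] at h3
      rw [dotProduct_comm, dotProduct] at h3
      exact h3.trans (mul_le_mul_of_nonneg_right hδ1 hb0)
    rw [h1]
    refine (abs_sub _ _).trans (add_le_add ?_ (he s s.2))
    rw [abs_mul]
    calc |x ⬝ᵥ δ| * |x s| ≤ (τ * b) * b :=
          mul_le_mul h2 (hb s s.2) (abs_nonneg _) (by positivity)
      _ = b ^ 2 * τ := by ring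
  have hstep : ∀ s : S, |(1 / (N : ℝ)) * ((blockSS M S)⁻¹ *ᵥ fun s => G s) s|
      ≤ √(S.card) * (b ^ 2 * τ / N + e) / c := by
    intro s
    have h := abs_inv_mulVec_le hc hM (by positivity) hGs s
    rw [Fintype.card_coe] at h
    rw [abs_mul, abs_of_pos (by positivity)]
    calc _ ≤ (1 / (N : ℝ)) * (√(S.card) * (b ^ 2 * τ + N * e) / c) :=
          mul_le_mul_of_nonneg_left h (by positivity)
      _ = _ := by field_simp
  have key : ∀ d, restrictedStep N M G (θs + δ) d ≠ 0 ↔ d ∈ S := by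
    intro d
    subst hsupp
    constructor
    · intro h
      by_contra hd
      exact h (by simp [restrictedStep, hd])
    · intro hd h0
      rw [restrictedStep, dif_pos hd, Pi.add_apply] at h0
      have h4 : θs d = -(δ d + (1 / (N : ℝ)) *
          ((blockSS M (supp (θs + δ)))⁻¹ *ᵥ fun s => G s) ⟨d, hd⟩) := by linarith
      have h3 := hθs d hd
      rw [h4, abs_neg] at h3
      exact absurd (h3.trans_le ((abs_add_le _ _).trans (add_le_add (hδr d) (hstep ⟨d, hd⟩))))
        (lt_irrefl _)
  ext d
  exact Finset.mem_filter.trans (by simp [key])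

theorem coercive_gram_erase (X : Matrix (Fin N) (Fin D) ℝ) (S : Finset (Fin D)) (n : Fin N)
    {c b r : ℝ} (hb : ∀ s ∈ S, |X n s| ≤ b) (hr : S.card * b ^ 2 / N ≤ r)
    (hM : ∀ v : S → ℝ, c * (v ⬝ᵥ v) ≤ v ⬝ᵥ (blockSS (gram X Finset.univ) S *ᵥ v)) (v : S → ℝ) :
    (c - r) * (v ⬝ᵥ v) ≤ v ⬝ᵥ (blockSS (gram X (Finset.univ.erase n)) S *ᵥ v) := by
  set u : S → ℝ := fun s => X n s with hu
  have h1 : blockSS (gram X (Finset.univ.erase n)) S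
      = blockSS (gram X Finset.univ) S - (1 / (N : ℝ)) • vecMulVec u u := by
    ext i j
    simp only [blockSS, submatrix_apply, gram_erase_apply, Matrix.sub_apply, Matrix.smul_apply, vecMulVec_apply,
      smul_eq_mul, hu]
    ring
  have h2 : v ⬝ᵥ (((1 / (N : ℝ)) • vecMulVec u u) *ᵥ v) = (u ⬝ᵥ v) ^ 2 / N := by
    simp only [smul_mulVec, dotProduct_smul, smul_eq_mul, vecMulVec_mulVec]
    simp [dotProduct_comm v]
    ring
  have h3 : (u ⬝ᵥ v) ^ 2 ≤ (S.card * b ^ 2) * (v ⬝ᵥ v) := by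
    have h4 := Finset.sum_mul_sq_le_sq_mul_sq Finset.univ u v
    have h5 : ∑ s, u s ^ 2 ≤ S.card * b ^ 2 := by
      calc ∑ s, u s ^ 2 ≤ ∑ _s : S, b ^ 2 :=
            Finset.sum_le_sum fun s _ => sq_le_sq' (abs_le.mp (hb s s.2)).1 (abs_le.mp (hb s s.2)).2
        _ = _ := by simp
    have h6 : ∑ s, v s ^ 2 = v ⬝ᵥ v := by simp [dotProduct, sq]
    rw [h6] at h4
    exact h4.trans (mul_le_mul_of_nonneg_right h5 (dotProduct_self_nonneg v))
  rw [h1, sub_mulVec, dotProduct_sub, h2]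
  have h7 : (u ⬝ᵥ v) ^ 2 / N ≤ r * (v ⬝ᵥ v) := by
    calc (u ⬝ᵥ v) ^ 2 / N ≤ (S.card * b ^ 2) * (v ⬝ᵥ v) / N :=
          div_le_div_of_nonneg_right h3 (Nat.cast_nonneg _)
      _ = (S.card * b ^ 2 / N) * (v ⬝ᵥ v) := by ring
      _ ≤ _ := mul_le_mul_of_nonneg_right hr (dotProduct_self_nonneg v)
  linarith [hM v]

theorem Incoherent.exists_row {X : Matrix (Fin N) (Fin D) ℝ} {S : Finset (Fin D)} {α : ℝ}
    (h : Incoherent X S α) (d : Fin D) (hd : d ∉ S) :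
    ∃ J : S → ℝ, (∀ s : S, gram X Finset.univ d s = ∑ t : S, J t * gram X Finset.univ t s) ∧
      ∑ t, |J t| ≤ 1 - α := by
  refine ⟨(blockScS (hess X) S * (blockSS (hess X) S)⁻¹) ⟨d, hd⟩, fun s => ?_, ?_⟩
  · have h1 : blockScS (hess X) S * (blockSS (hess X) S)⁻¹ * blockSS (hess X) S
        = blockScS (hess X) S := by
      rw [Matrix.mul_assoc, Matrix.nonsing_inv_mul _ h.1, Matrix.mul_one]
    have h2 := congrFun (congrFun h1 ⟨d, hd⟩) s
    rw [Matrix.mul_apply] at h2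
    exact h2.symm
  · refine le_trans ?_ h.2.le
    exact le_ciSup (f := fun i => ∑ j, |(blockScS (hess X) S * (blockSS (hess X) S)⁻¹) i j|)
      (Set.finite_range _).bddAbove ⟨d, hd⟩

theorem Incoherent.lt_one {X : Matrix (Fin N) (Fin D) ℝ} {S : Finset (Fin D)} {α : ℝ}
    (h : Incoherent X S α) : α < 1 := by
  have : 0 ≤ rowSumNorm (blockScS (hess X) S * (blockSS (hess X) S)⁻¹) :=
    Real.iSup_nonneg fun i => Finset.sum_nonneg fun j _ => abs_nonneg _
  linarith [h.2]

/-- The deterministic core: on the event described by the hypotheses, the full-data problem and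
all leave-one-out problems satisfy the primal-dual certificate with coercivity constant `1/2`,
noise level `g + e` and incoherence `7 α / 8`. The hypothesis `hκ` bounds the change of the Gram
block and `hm` the change of a row in the incoherence condition. -/
theorem supportStable_of_bounds (X : Matrix (Fin N) (Fin D) ℝ) (ε : Fin N → ℝ) (θs : Fin D → ℝ)
    {lam α b B e g : ℝ} (S : Finset (Fin D)) (hN : 0 < N) (hS : supp θs = S) (hα : 0 < α)
    (hlam : 0 < lam) (hb0 : 0 ≤ b) (hg0 : 0 ≤ g) (he0 : 0 ≤ e)
    (hinc : Incoherent X S α)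
    (hM : ∀ v : S → ℝ, (3 / 4) * (v ⬝ᵥ v) ≤ v ⬝ᵥ (blockSS (hess X) S *ᵥ v))
    (hw : ∀ d, |(1 / (N : ℝ)) * ∑ m, ε m * X m d| ≤ g)
    (he : ∀ n d, |ε n * X n d| ≤ N * e)
    (hb : ∀ n, ∀ s ∈ S, |X n s| ≤ b) (hB : ∀ n d, |X n d| ≤ B)
    (hκ : S.card * b ^ 2 / N ≤ 1 / 32)
    (hm : (b + B) / N * (S.card * b / (1 / 2)) ≤ α / 8)
    (hge : g + e ≤ 3 / 8 * α * lam)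
    (hθs : ∀ s ∈ S, √(S.card) * 4 * lam < |θs s|) :
    SupportStable X (fun m => X m ⬝ᵥ θs + ε m) lam S := by
  have hα1 := hinc.lt_one
  have hN' : (0 : ℝ) < N := Nat.cast_pos.mpr hN
  have hαl : α * lam ≤ lam := by nlinarith
  have hge0 : 0 ≤ g + e := by linarith
  have hge' : g + e ≤ 3 / 8 * lam := by nlinarith
  have hdev : ∀ s ∈ S, √(S.card : ℝ) * (g + e + lam) / (1 / 2) < |θs s| := by
    intro s hs
    refine lt_of_le_of_lt ?_ (hθs s hs)
    have : √(S.card : ℝ) * (g + e + lam) / (1 / 2) = √(S.card : ℝ) * (2 * (g + e + lam)) := by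
      ring
    rw [this, mul_assoc]
    exact mul_le_mul_of_nonneg_left (by linarith) (Real.sqrt_nonneg _)
  have hgβ : (2 - 7 / 8 * α) * (g + e) < 7 / 8 * α * lam := by nlinarith
  have hMu : ∀ v : S → ℝ, (1 / 2) * (v ⬝ᵥ v) ≤ v ⬝ᵥ (blockSS (gram X Finset.univ) S *ᵥ v) := by
    intro v
    have h1 := hM v
    rw [hess_eq_gram] at h1
    linarith [dotProduct_self_nonneg v]
  have hMe : ∀ (n : Fin N) (v : S → ℝ), (1 / 2) * (v ⬝ᵥ v) ≤
      v ⬝ᵥ (blockSS (gram X (Finset.univ.erase n)) S *ᵥ v) := by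
    intro n v
    have := coercive_gram_erase X S n (hb n) hκ (fun v => by rw [← hess_eq_gram]; exact hM v) v
    linarith [dotProduct_self_nonneg v]
  have hwe : ∀ n d, |(1 / (N : ℝ)) * ∑ m ∈ Finset.univ.erase n, ε m * X m d| ≤ g + e := by
    intro n d
    have h1 : (1 / (N : ℝ)) * ∑ m ∈ Finset.univ.erase n, ε m * X m d
        = (1 / (N : ℝ)) * ∑ m, ε m * X m d - (ε n * X n d) / N := by
      rw [← Finset.sum_erase_add _ _ (Finset.mem_univ n)]; ring
    rw [h1]
    refine (abs_sub _ _).trans (add_le_add (hw d) ?_)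
    rw [abs_div, Nat.abs_cast, div_le_iff₀ hN', mul_comm e]
    exact he n d
  have hfull := exists_solution_of_incoherence X ε θs Finset.univ S hS hlam
    (by norm_num : (0 : ℝ) < 1 / 2) hge0 hgβ hMu
    (fun d hd => by
      obtain ⟨J, h1, h2⟩ := hinc.exists_row d hd
      exact ⟨J, h1, by linarith⟩)
    (fun d => (hw d).trans (by linarith)) hdev
  have hloo := fun n : Fin N => exists_solution_of_incoherence X ε θs (Finset.univ.erase n) S hS
    hlam (by norm_num : (0 : ℝ) < 1 / 2) hge0 hgβ (hMe n)
    (fun d hd => by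
      obtain ⟨J, h1, h2⟩ := hinc.exists_row d hd
      obtain ⟨J', h3, h4⟩ := incoherence_erase X S n (by norm_num) hb0 (hMe n) (hb n) (hB n d)
        (by linarith) h1 h2
      exact ⟨J', h3, by linarith⟩)
    (hwe n) hdev
  obtain ⟨δ, hδ0, hδb, hδ1, hδs, hsol, huniq⟩ := hfull
  refine ⟨⟨θs + δ, hsol, huniq⟩, fun n => ?_, fun θhat hθhat n => ?_⟩
  · obtain ⟨δ', -, -, -, -, hsol', huniq'⟩ := hloo n
    exact ⟨θs + δ', hsol', huniq'⟩
  · obtain rfl := huniq θhat hθhat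
    have hτ : ∀ s ∈ S, √(S.card) * (g + e + lam) / (1 / 2)
        + √(S.card) * (b ^ 2 * (S.card * (g + e + lam) / (1 / 2)) / N + e) / (1 / 2)
          < |θs s| := by
      intro s hs
      refine lt_of_le_of_lt ?_ (hθs s hs)
      have h1 : √(S.card : ℝ) * (g + e + lam) / (1 / 2)
          + √(S.card) * (b ^ 2 * (S.card * (g + e + lam) / (1 / 2)) / N + e) / (1 / 2)
          = √(S.card) * (2 * (g + e + lam)
            + 4 * (S.card * b ^ 2 / N) * (g + e + lam) + 2 * e) := by ring
      rw [h1, mul_assoc _ 4 lam]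
      refine mul_le_mul_of_nonneg_left ?_ (Real.sqrt_nonneg _)
      have h2 : (S.card * b ^ 2 / N) * (g + e + lam) ≤ 1 / 32 * (g + e + lam) :=
        mul_le_mul_of_nonneg_right hκ (by linarith)
      linarith
    have hstep : ∀ M : Matrix (Fin D) (Fin D) ℝ,
        (∀ v : S → ℝ, (1 / 2) * (v ⬝ᵥ v) ≤ v ⬝ᵥ (blockSS M S *ᵥ v)) →
        supp (restrictedStep N M (gradLoss (X n) (X n ⬝ᵥ θs + ε n) (θs + δ)) (θs + δ)) = S :=
      fun M hM' => supp_restrictedStep M S (X n) θs δ hN (by norm_num) hb0 he0 hS hM' hδ0 hδb hδ1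
        hδs (hb n) (fun s _ => he n s) hτ
    have hMe' : ∀ v : S → ℝ, (1 / 2) * (v ⬝ᵥ v) ≤ v ⬝ᵥ (blockSS (hessMinus X n) S *ᵥ v) := by
      rw [hessMinus_eq_gram]; exact hMe n
    refine ⟨?_, ?_, hstep _ hMu, hstep _ hMe', ?_⟩
    · rw [hδs]; exact isUnit_det_of_coercive (by norm_num) hMu
    · rw [hδs]; exact isUnit_det_of_coercive (by norm_num) hMe'
    · obtain ⟨δ', -, -, -, hδs', -, huniq'⟩ := hloo n
      intro θn hθn
      rw [huniq' θn hθn, hδs']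

end Recovery

/-! ### Sub-exponential tails -/

section Tails

variable {Ω : Type*} [MeasurableSpace Ω] {μ : Measure Ω}

/-- `W` is `K`-sub-exponential: `E exp(|W| / K) ≤ 2`. -/
structure IsSubExponential (W : Ω → ℝ) (K : ℝ) (μ : Measure Ω) : Prop where
  measurable : Measurable W
  integrable_exp : Integrable (fun ω => Real.exp (|W ω| / K)) μ
  integral_exp_le : ∫ ω, Real.exp (|W ω| / K) ∂μ ≤ 2

theorem IsSubGaussian.sq_isSubExponential {V : Ω → ℝ} {c : ℝ} (hV : Measurable V)
    (h : IsSubGaussian V c μ) : IsSubExponential (fun ω => V ω ^ 2) (c ^ 2) μ := by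
  have h0 : ∀ ω, |V ω ^ 2| / c ^ 2 = V ω ^ 2 / c ^ 2 := fun ω => by rw [abs_of_nonneg (sq_nonneg _)]
  have hnn : 0 ≤ᵐ[μ] fun ω => Real.exp (V ω ^ 2 / c ^ 2) :=
    Filter.Eventually.of_forall fun ω => (Real.exp_pos _).le
  have hm : Measurable fun ω => Real.exp (V ω ^ 2 / c ^ 2) := by fun_prop
  refine ⟨by fun_prop, ?_, ?_⟩ <;> simp only [h0]
  · refine ⟨hm.aestronglyMeasurable, ?_⟩
    rw [hasFiniteIntegral_iff_ofReal hnn]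
    exact lt_of_le_of_lt h (by simp)
  · rw [integral_eq_lintegral_of_nonneg_ae hnn hm.aestronglyMeasurable]
    exact ENNReal.toReal_le_of_le_ofReal (by norm_num) (by rw [ENNReal.ofReal_ofNat]; exact h)

/-- The product of two sub-Gaussian variables is sub-exponential, whatever their dependence. -/
theorem IsSubGaussian.mul_isSubExponential {V U : Ω → ℝ} {c c' : ℝ} (hV : Measurable V)
    (hU : Measurable U) (h : IsSubGaussian V c μ)
    (h' : IsSubGaussian U c' μ) : IsSubExponential (fun ω => V ω * U ω) (c * c') μ := by
  have h1 := h.sq_isSubExponential hV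
  have h2 := h'.sq_isSubExponential hU
  have key : ∀ ω, Real.exp (|V ω * U ω| / (c * c'))
      ≤ (Real.exp (|V ω ^ 2| / c ^ 2) + Real.exp (|U ω ^ 2| / c' ^ 2)) / 2 := by
    intro ω
    set a := |V ω| / c with ha
    set b := |U ω| / c' with hb
    have e1 : |V ω * U ω| / (c * c') = a * b := by rw [abs_mul, ha, hb, mul_div_mul_comm]
    have e2 : |V ω ^ 2| / c ^ 2 = a ^ 2 := by rw [abs_pow, ha, div_pow]
    have e3 : |U ω ^ 2| / c' ^ 2 = b ^ 2 := by rw [abs_pow, hb, div_pow]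
    rw [e1, e2, e3]
    have h3 : Real.exp (a * b) ≤ Real.exp (a ^ 2 / 2) * Real.exp (b ^ 2 / 2) := by
      rw [← Real.exp_add]
      exact Real.exp_le_exp.mpr (by nlinarith [sq_nonneg (a - b)])
    have h4 : ∀ t : ℝ, Real.exp t = Real.exp (t / 2) ^ 2 := fun t => by
      rw [← Real.exp_nat_mul]; congr 1; push_cast; ring
    rw [h4 (a ^ 2), h4 (b ^ 2)]
    nlinarith [sq_nonneg (Real.exp (a ^ 2 / 2) - Real.exp (b ^ 2 / 2))]
  have hint := (h1.integrable_exp.add h2.integrable_exp).div_const 2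
  refine ⟨by fun_prop, hint.mono' (by fun_prop) (Filter.Eventually.of_forall fun ω => ?_), ?_⟩
  · rw [Real.norm_of_nonneg (Real.exp_pos _).le]
    exact key ω
  · calc _ ≤ ∫ ω, (Real.exp (|V ω ^ 2| / c ^ 2) + Real.exp (|U ω ^ 2| / c' ^ 2)) / 2 ∂μ :=
          integral_mono_of_nonneg (Filter.Eventually.of_forall fun ω => (Real.exp_pos _).le) hint
            (Filter.Eventually.of_forall key)
      _ ≤ 2 := by
          rw [integral_div, integral_add h1.integrable_exp h2.integrable_exp]
          linarith [h1.integral_exp_le, h2.integral_exp_le]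

variable {W : Ω → ℝ} {K : ℝ}

theorem IsSubExponential.tail (h : IsSubExponential W K μ) (hK : 0 < K) (t : ℝ) :
    μ.real {ω | K * t ≤ |W ω|} ≤ 2 * Real.exp (-t) := by
  have h1 := mul_meas_ge_le_integral_of_nonneg
    (Filter.Eventually.of_forall fun ω => (Real.exp_pos (|W ω| / K)).le) h.integrable_exp
    (Real.exp t)
  have h2 : {ω | K * t ≤ |W ω|} = {ω | Real.exp t ≤ Real.exp (|W ω| / K)} := by
    ext ω
    simp only [Set.mem_ofPred_eq, Real.exp_le_exp, le_div_iff₀ hK, mul_comm]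
  rw [h2, Real.exp_neg, ← div_eq_mul_inv, le_div_iff₀ (Real.exp_pos _), mul_comm]
  exact h1.trans h.integral_exp_le

theorem sq_le_mul_exp_abs_div (hK : 0 < K) (w : ℝ) : w ^ 2 ≤ 2 * K ^ 2 * Real.exp (|w| / K) := by
  have h := Real.quadratic_le_exp_of_nonneg (x := |w| / K) (by positivity)
  have h0 : 0 ≤ |w| / K := by positivity
  have e : w ^ 2 = K ^ 2 * (|w| / K) ^ 2 := by
    rw [div_pow, sq_abs]; field_simp
  rw [e]
  have hK2 : 0 < K ^ 2 := by positivity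
  nlinarith

theorem IsSubExponential.integrable_sq (h : IsSubExponential W K μ) (hK : 0 < K) :
    Integrable (fun ω => W ω ^ 2) μ := by
  have := h.measurable
  refine (h.integrable_exp.const_mul (2 * K ^ 2)).mono' (by fun_prop)
    (Filter.Eventually.of_forall fun ω => ?_)
  rw [Real.norm_of_nonneg (sq_nonneg _)]
  exact sq_le_mul_exp_abs_div hK _

theorem IsSubExponential.integral_sq_le (h : IsSubExponential W K μ) (hK : 0 < K) :
    ∫ ω, W ω ^ 2 ∂μ ≤ 4 * K ^ 2 := by
  calc ∫ ω, W ω ^ 2 ∂μ ≤ ∫ ω, 2 * K ^ 2 * Real.exp (|W ω| / K) ∂μ :=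
        integral_mono (h.integrable_sq hK) (h.integrable_exp.const_mul _)
          fun ω => sq_le_mul_exp_abs_div hK _
    _ = 2 * K ^ 2 * ∫ ω, Real.exp (|W ω| / K) ∂μ := integral_const_mul _ _
    _ ≤ 4 * K ^ 2 := by nlinarith [h.integral_exp_le, sq_nonneg K]

theorem IsSubExponential.memLp (h : IsSubExponential W K μ) (hK : 0 < K) : MemLp W 2 μ :=
  (memLp_two_iff_integrable_sq h.measurable.aestronglyMeasurable).mpr (h.integrable_sq hK)

theorem IsSubExponential.integrable [IsProbabilityMeasure μ] (h : IsSubExponential W K μ) (hK : 0 < K) : Integrable W μ :=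
  (h.memLp hK).integrable (by norm_num)

theorem IsSubExponential.integrable_exp_mul (h : IsSubExponential W K μ) (hK : 0 < K) {s : ℝ}
    (hs : |s| * K ≤ 1 / 2) : Integrable (fun ω => Real.exp (s * W ω)) μ := by
  have := h.measurable
  refine h.integrable_exp.mono' (by fun_prop) (Filter.Eventually.of_forall fun ω => ?_)
  rw [Real.norm_of_nonneg (Real.exp_pos _).le, Real.exp_le_exp, le_div_iff₀ hK]
  calc s * W ω * K ≤ |s * W ω| * K := mul_le_mul_of_nonneg_right (le_abs_self _) hK.le
    _ = (|s| * K) * |W ω| := by rw [abs_mul]; ring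
    _ ≤ |W ω| := by nlinarith [abs_nonneg (W ω)]

/-- The moment generating function of a centered sub-exponential variable is sub-Gaussian
near zero. -/
theorem IsSubExponential.mgf_le [IsProbabilityMeasure μ] (h : IsSubExponential W K μ) (hK : 0 < K)
    (hmean : ∫ ω, W ω ∂μ = 0) {s : ℝ} (hs : |s| * K ≤ 1 / 2) :
    mgf W μ s ≤ Real.exp (16 * (s * K) ^ 2) := by
  have key : ∀ ω, Real.exp (s * W ω)
      ≤ 1 + s * W ω + 8 * (s * K) ^ 2 * Real.exp (|W ω| / K) := by
    intro ω
    set z := s * W ω with hz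
    set a := |W ω| / K with ha
    have ha0 : 0 ≤ a := by positivity
    have h1 : Real.exp z - 1 - z ≤ z ^ 2 * Real.exp |z| := by
      have h2 := Complex.norm_exp_sub_sum_le_norm_mul_exp (z : ℂ) 2
      have h3 : Complex.exp (z : ℂ) - ∑ m ∈ Finset.range 2, (z : ℂ) ^ m / (m.factorial : ℂ)
          = ((Real.exp z - 1 - z : ℝ) : ℂ) := by
        simp [Finset.sum_range_succ]; ring
      rw [h3, Complex.norm_real, Complex.norm_real, Real.norm_eq_abs, Real.norm_eq_abs,
        sq_abs] at h2
      exact (le_abs_self _).trans h2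
    have hza : |z| = (|s| * K) * a := by
      rw [hz, abs_mul, ha]; field_simp
    have hz2 : z ^ 2 = (s * K) ^ 2 * a ^ 2 := by
      rw [← sq_abs, hza, mul_pow, mul_pow, mul_pow, sq_abs]
    have h4 : Real.exp |z| ≤ Real.exp (a / 2) := Real.exp_le_exp.mpr (by rw [hza]; nlinarith)
    have h5 : a ^ 2 ≤ 8 * Real.exp (a / 2) := by
      nlinarith [Real.quadratic_le_exp_of_nonneg (x := a / 2) (by positivity)]
    have h6 : Real.exp a = Real.exp (a / 2) * Real.exp (a / 2) := by
      rw [← Real.exp_add]; congr 1; ring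
    have h7 : z ^ 2 * Real.exp |z| ≤ 8 * (s * K) ^ 2 * Real.exp a := by
      rw [hz2, h6]
      calc (s * K) ^ 2 * a ^ 2 * Real.exp |z|
          ≤ (s * K) ^ 2 * (8 * Real.exp (a / 2)) * Real.exp (a / 2) := by
            gcongr
        _ = _ := by ring
    linarith
  have hi1 : Integrable (fun ω => 1 + s * W ω) μ :=
    (integrable_const 1).add ((h.integrable hK).const_mul s)
  have hi2 : Integrable (fun ω => 8 * (s * K) ^ 2 * Real.exp (|W ω| / K)) μ :=
    h.integrable_exp.const_mul _
  calc mgf W μ s ≤ ∫ ω, (1 + s * W ω + 8 * (s * K) ^ 2 * Real.exp (|W ω| / K)) ∂μ :=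
        integral_mono (h.integrable_exp_mul hK hs) (hi1.add hi2) key
    _ = 1 + 8 * (s * K) ^ 2 * ∫ ω, Real.exp (|W ω| / K) ∂μ := by
        rw [integral_add hi1 hi2, integral_add (integrable_const 1)
          ((h.integrable hK).const_mul s), integral_const_mul, integral_const_mul, hmean]
        simp
    _ ≤ 1 + 16 * (s * K) ^ 2 := by nlinarith [h.integral_exp_le, sq_nonneg (s * K)]
    _ ≤ _ := by linarith [Real.add_one_le_exp (16 * (s * K) ^ 2)]

/-- Bernstein's inequality in the regime of deviations `10 K q N` with `q ≤ 1`. -/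
theorem bernstein [IsProbabilityMeasure μ] {N : ℕ} {W : Fin N → Ω → ℝ} (hK : 0 < K) (hind : iIndepFun W μ)
    (h : ∀ n, IsSubExponential (W n) K μ) (hmean : ∀ n, ∫ ω, W n ω ∂μ = 0) {q : ℝ} (hq0 : 0 ≤ q)
    (hq1 : q ≤ 1) :
    μ.real {ω | 10 * K * q * N ≤ |∑ n, W n ω|} ≤ 2 * Real.exp (-(q ^ 2 * N)) := by
  have hone : ∀ V : Fin N → Ω → ℝ, iIndepFun V μ → (∀ n, IsSubExponential (V n) K μ) →
      (∀ n, ∫ ω, V n ω ∂μ = 0) →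
      μ.real {ω | 10 * K * q * N ≤ (∑ n, V n) ω} ≤ Real.exp (-(q ^ 2 * N)) := by
    intro V hVi hV hVm
    -- the exponent `-10 s K q N + 16 (s K)² N` is smallest near this `s`
    set s := q / (2 * K) with hs
    have hsK : s * K = q / 2 := by rw [hs]; field_simp
    have hs0 : 0 ≤ s := by positivity
    have hsK' : |s| * K ≤ 1 / 2 := by rw [abs_of_nonneg hs0, hsK]; linarith
    have hmeas : ∀ n, Measurable (V n) := fun n => (hV n).measurable
    have h1 := measure_ge_le_exp_mul_mgf (μ := μ) (X := ∑ n, V n) (t := s) (10 * K * q * N) hs0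
      (hVi.integrable_exp_mul_sum hmeas fun n _ => (hV n).integrable_exp_mul hK hsK')
    refine h1.trans ?_
    rw [hVi.mgf_sum hmeas]
    calc Real.exp (-s * (10 * K * q * N)) * ∏ n, mgf (V n) μ s
        ≤ Real.exp (-s * (10 * K * q * N)) * ∏ _n : Fin N, Real.exp (16 * (s * K) ^ 2) :=
          mul_le_mul_of_nonneg_left (Finset.prod_le_prod (fun n _ => mgf_nonneg)
            fun n _ => (hV n).mgf_le hK (hVm n) hsK') (Real.exp_pos _).le
      _ = Real.exp (-(q ^ 2 * N)) := by
          rw [Finset.prod_const, Finset.card_univ, Fintype.card_fin, ← Real.exp_nat_mul,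
            ← Real.exp_add]
          congr 1
          have : s * (10 * K * q * N) = 10 * (s * K) * q * N := by ring
          rw [neg_mul, this, hsK]; ring
  have hneg : ∀ n, IsSubExponential (fun ω => -W n ω) K μ := fun n =>
    ⟨(h n).measurable.neg, by simpa only [abs_neg] using (h n).integrable_exp,
      by simpa only [abs_neg] using (h n).integral_exp_le⟩
  have h1 := hone W hind h hmean
  have h2 := hone (fun n ω => -W n ω) (hind.comp (fun _ t => -t) fun _ => measurable_neg) hneg
    (fun n => by rw [integral_neg, hmean n, neg_zero])
  have h3 : {ω | 10 * K * q * N ≤ |∑ n, W n ω|} ⊆ {ω | 10 * K * q * N ≤ (∑ n, W n) ω} ∪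
      {ω | 10 * K * q * N ≤ (∑ n, fun ω => -W n ω) ω} := by
    intro ω hω
    simp only [Set.mem_union, Set.mem_ofPred_eq, Finset.sum_apply, Finset.sum_neg_distrib] at hω ⊢
    exact le_abs.mp hω
  calc _ ≤ _ := measureReal_mono h3
    _ ≤ _ := measureReal_union_le _ _
    _ ≤ _ := by linarith

theorem two_mul_exp_neg_le : 2 * Real.exp (-26) ≤ Real.exp (-25) := by
  have h1 : Real.exp (-25) = Real.exp 1 * Real.exp (-26) := by
    rw [← Real.exp_add]; norm_num
  rw [h1]
  have := Real.add_one_le_exp (1 : ℝ)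
  nlinarith [Real.exp_pos (-26)]

/-- Union bound in the form used below: the `26` in the exponent absorbs the factor `2` of a
two-sided tail and leaves `e^{-25}`. -/
theorem measureReal_exists_le [IsFiniteMeasure μ] {ι : Type*} [Fintype ι] (p : ι → Ω → Prop) {L : ℝ}
    (hL : Real.log (Fintype.card ι) + 26 ≤ L)
    (h : ∀ i, μ.real {ω | p i ω} ≤ 2 * Real.exp (-L)) :
    μ.real {ω | ∃ i, p i ω} ≤ Real.exp (-25) := by
  rw [Set.ofPred_exists]
  refine (measureReal_iUnion_fintype_le _).trans ?_
  refine (Finset.sum_le_sum fun i _ => h i).trans ?_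
  rw [Finset.sum_const, Finset.card_univ, nsmul_eq_mul]
  rcases (Fintype.card ι).eq_zero_or_pos with h0 | h0
  · rw [h0, Nat.cast_zero, zero_mul]; exact (Real.exp_pos _).le
  · have h1 : (0 : ℝ) < Fintype.card ι := Nat.cast_pos.mpr h0
    have h2 : Real.exp (-L) ≤ (Fintype.card ι : ℝ)⁻¹ * Real.exp (-26) := by
      rw [← Real.exp_log (inv_pos.mpr h1), ← Real.exp_add, Real.log_inv]
      exact Real.exp_le_exp.mpr (by linarith)
    calc (Fintype.card ι : ℝ) * (2 * Real.exp (-L))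
        ≤ Fintype.card ι * (2 * ((Fintype.card ι : ℝ)⁻¹ * Real.exp (-26))) := by gcongr
      _ = 2 * Real.exp (-26) := by field_simp
      _ ≤ _ := two_mul_exp_neg_le

end Tails

/-! ### High-probability bounds in the random linear model -/

section Model

variable {Ω : Type*} [MeasurableSpace Ω] {μ : Measure Ω} {N D : ℕ}
  {x : Fin N → Fin D → Ω → ℝ} {ε : Fin N → Ω → ℝ} {θs : Fin D → ℝ} {cx ce : ℝ}

theorem measurable_det {ι : Type*} [Fintype ι] [DecidableEq ι] {M : Ω → Matrix ι ι ℝ}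
    (hM : ∀ i j, Measurable fun ω => M ω i j) : Measurable fun ω => (M ω).det := by
  simp only [det_apply]
  fun_prop

theorem measurable_inv_apply {ι : Type*} [Fintype ι] [DecidableEq ι] {M : Ω → Matrix ι ι ℝ}
    (hM : ∀ i j, Measurable fun ω => M ω i j) (i j : ι) : Measurable fun ω => (M ω)⁻¹ i j := by
  have h1 : Measurable fun ω => (updateRow (M ω) j (Pi.single i 1)).det := by
    refine measurable_det fun k l => ?_
    rcases eq_or_ne k j with rfl | hk
    · simp only [updateRow_self, measurable_const]
    · simp only [updateRow_ne hk, hM]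
  have h2 : ∀ ω, (M ω)⁻¹ i j = (M ω).det⁻¹ * (updateRow (M ω) j (Pi.single i 1)).det := fun ω => by
    rw [inv_def, Matrix.smul_apply, Ring.inverse_eq_inv', smul_eq_mul, adjugate_apply]
  simp only [h2]
  exact (measurable_det hM).inv.mul h1

/-- Measurability allows passing to the complement of the incoherence event, for which only a lower
bound on the outer measure is assumed. -/
theorem measurableSet_incoherent (hx : ∀ n d, Measurable (x n d)) (S : Finset (Fin D)) (α : ℝ) :
    MeasurableSet {ω | Incoherent (design x ω) S α} := by
  have hH : ∀ i j, Measurable fun ω => hess (design x ω) i j := by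
    intro i j
    simp only [hess_eq_gram, gram_apply, design, of_apply]
    fun_prop
  have hSS : ∀ i j, Measurable fun ω => blockSS (hess (design x ω)) S i j := fun i j => hH i j
  have hinv := measurable_inv_apply hSS
  have hnorm : Measurable fun ω =>
      rowSumNorm (blockScS (hess (design x ω)) S * (blockSS (hess (design x ω)) S)⁻¹) := by
    refine Measurable.iSup fun i => Finset.measurable_fun_sum _ fun j _ => ?_
    refine continuous_abs.measurable.comp ?_
    simp only [mul_apply]
    exact Finset.measurable_fun_sum _ fun k _ => (hH i k).mul (hinv k j)
  have : {ω | Incoherent (design x ω) S α} = {ω | (blockSS (hess (design x ω)) S).det ≠ 0} ∩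
      {ω | rowSumNorm (blockScS (hess (design x ω)) S * (blockSS (hess (design x ω)) S)⁻¹)
        < 1 - α} := by
    ext ω
    simp [Incoherent, isUnit_iff_ne_zero]
  rw [this]
  exact (measurableSet_eq_fun (measurable_det hSS) measurable_const).compl.inter
    (measurableSet_lt hnorm measurable_const)

theorem LinearModel.noise_mul_isSubExponential (h : LinearModel μ x ε θs cx ce)
    (n : Fin N)
    (d : Fin D) : IsSubExponential (fun ω => ε n ω * x n d ω) (ce * cx) μ :=
  (h.subGaussian_noise n).mul_isSubExponential (h.measurable_noise n) (h.measurable_x n d)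
    (h.subGaussian_x n d)

theorem LinearModel.mul_isSubExponential (h : LinearModel μ x ε θs cx ce)
    (n : Fin N) (i j : Fin D) :
    IsSubExponential (fun ω => x n i ω * x n j ω) (cx * cx) μ :=
  (h.subGaussian_x n i).mul_isSubExponential (h.measurable_x n i) (h.measurable_x n j)
    (h.subGaussian_x n j)

/-- Minimality of the population loss at `θs` makes the noise uncorrelated with each covariate. -/
theorem LinearModel.integral_noise_mul_eq_zero [IsProbabilityMeasure μ] (h : LinearModel μ x ε θs cx ce)
    (hcx : 0 < cx) (hce : 0 < ce) (n : Fin N)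
    (d : Fin D) : ∫ ω, ε n ω * x n d ω ∂μ = 0 := by
  set m := ∫ ω, ε n ω * x n d ω ∂μ with hm
  have hi1 : Integrable (fun ω => ε n ω * x n d ω) μ :=
    (h.noise_mul_isSubExponential n d).integrable (by positivity)
  have hi2 : Integrable (fun ω => ε n ω ^ 2) μ :=
    ((h.subGaussian_noise n).sq_isSubExponential (h.measurable_noise n)).integrable (by positivity)
  have hi3 : Integrable (fun ω => x n d ω ^ 2) μ :=
    ((h.subGaussian_x n d).sq_isSubExponential (h.measurable_x n d)).integrable (by positivity)
  -- moving from `θs` by `m` along coordinate `d` changes the population loss by `-m² / 2`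
  have h1 := h.population_min n (θs + Pi.single d m)
  have e1 : ∀ ω, sqLoss (design x ω n ⬝ᵥ θs) (response x ε θs ω n) = ε n ω ^ 2 / 2 := by
    intro ω; simp only [sqLoss, response]; ring
  have e2 : ∀ ω, sqLoss (design x ω n ⬝ᵥ (θs + Pi.single d m)) (response x ε θs ω n)
      = ε n ω ^ 2 / 2 + (m ^ 2 / 2 * x n d ω ^ 2 - m * (ε n ω * x n d ω)) := by
    intro ω
    simp only [sqLoss, response, dotProduct_add, dotProduct_single]
    simp only [design, of_apply]
    ring
  simp only [e1, e2] at h1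
  have hi4 : Integrable (fun ω => m ^ 2 / 2 * x n d ω ^ 2 - m * (ε n ω * x n d ω)) μ :=
    (hi3.const_mul _).sub (hi1.const_mul _)
  rw [integral_add (hi2.div_const 2) hi4, integral_sub (hi3.const_mul _) (hi1.const_mul _),
    integral_const_mul, integral_const_mul, h.second_moment_x, ← hm] at h1
  nlinarith

/-- Uniform Bernstein bound over the coordinates; the union bound is paid for by `log D`. -/
theorem LinearModel.noise_corr_bound [IsProbabilityMeasure μ] (h : LinearModel μ x ε θs cx ce)
    (hcx : 0 < cx) (hce : 0 < ce) {q : ℝ}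
    (hq0 : 0 ≤ q) (hq1 : q ≤ 1) (hq : Real.log D + 26 ≤ q ^ 2 * N) :
    μ.real {ω | ∃ d, 10 * (ce * cx) * q * N ≤ |∑ n, ε n ω * x n d ω|} ≤ Real.exp (-25) := by
  refine measureReal_exists_le (L := q ^ 2 * N) _ (by simpa using hq) fun d => ?_
  refine bernstein (W := fun n ω => ε n ω * x n d ω) (by positivity) ?_
    (fun n => h.noise_mul_isSubExponential n d) (fun n =>
    h.integral_noise_mul_eq_zero hcx hce n d) hq0 hq1
  exact h.indep_points.comp (fun _ p => p.2 * p.1 d) fun _ => by fun_prop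

theorem LinearModel.noise_mul_bound [IsFiniteMeasure μ] (h : LinearModel μ x ε θs cx ce)
    (hcx : 0 < cx) (hce : 0 < ce) :
    μ.real {ω | ∃ p : Fin N × Fin D, ce * cx * (Real.log (N * D) + 26) ≤ |ε p.1 ω * x p.1 p.2 ω|}
      ≤ Real.exp (-25) := by
  refine measureReal_exists_le (L := Real.log (N * D) + 26) _ (by simp) fun p => ?_
  exact (h.noise_mul_isSubExponential p.1 p.2).tail (by positivity) _

theorem LinearModel.covariate_bound [IsFiniteMeasure μ] (h : LinearModel μ x ε θs cx ce)
    (hcx : 0 < cx) (S : Finset (Fin D)) :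
    μ.real {ω | ∃ p : Fin N × S, cx ^ 2 * (Real.log (N * S.card) + 26) ≤ |x p.1 p.2 ω ^ 2|}
      ≤ Real.exp (-25) := by
  refine measureReal_exists_le (L := Real.log (N * S.card) + 26) _ (by simp) fun p => ?_
  exact ((h.subGaussian_x p.1 p.2).sq_isSubExponential (h.measurable_x _ _)).tail (by positivity) _

theorem LinearModel.integral_mul_eq (h : LinearModel μ x ε θs cx ce)
    (i j : Fin D) (n : Fin N) :
    ∫ ω, x n i ω * x n j ω ∂μ = (1 : Matrix (Fin D) (Fin D) ℝ) i j := by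
  by_cases hij : i = j
  · subst hij
    simpa [sq] using h.second_moment_x n i
  · have h1 : IndepFun (x n i) (x n j) μ :=
      h.indep_x.indepFun (i := (n, i)) (j := (n, j)) (by simpa using hij)
    rw [h1.integral_fun_mul_eq_mul_integral (h.measurable_x n i).aestronglyMeasurable
      (h.measurable_x n j).aestronglyMeasurable, h.mean_x, zero_mul, one_apply_ne hij]

/-- Each entry of the Gram matrix has variance at most `4 cx⁴ / N`. -/
theorem LinearModel.integral_gram_sub_sq_le [IsProbabilityMeasure μ] (h : LinearModel μ x ε θs cx ce)
    (hcx : 0 < cx) (hN : 0 < N) (i j : Fin D) :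
    Integrable (fun ω => (hess (design x ω) i j - (1 : Matrix (Fin D) (Fin D) ℝ) i j) ^ 2) μ ∧
    ∫ ω, (hess (design x ω) i j - (1 : Matrix (Fin D) (Fin D) ℝ) i j) ^ 2 ∂μ
      ≤ 4 * cx ^ 4 / N := by
  have hN' : (0 : ℝ) < N := Nat.cast_pos.mpr hN
  set Z : Fin N → Ω → ℝ := fun n ω => x n i ω * x n j ω with hZ
  have hZs : ∀ n, IsSubExponential (Z n) (cx * cx) μ := fun n => h.mul_isSubExponential n i j
  have hcc : 0 < cx * cx := by positivity
  have hZ2 : ∀ n, MemLp (Z n) 2 μ := fun n => (hZs n).memLp hcc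
  have hind : iIndepFun Z μ :=
    h.indep_points.comp (fun _ p => p.1 i * p.1 j) fun _ => by fun_prop
  have hsum : MemLp (∑ n, Z n) 2 μ := memLp_finsetSum' _ fun n _ => hZ2 n
  set T : Ω → ℝ := fun ω => (1 / (N : ℝ)) * (∑ n, Z n) ω with hT
  have hT2 : MemLp T 2 μ := hsum.const_mul _
  have hHT : ∀ ω, hess (design x ω) i j = T ω := by
    intro ω
    simp [hess_eq_gram, gram_apply, design, hT, hZ]
  have hmean : ∫ ω, T ω ∂μ = (1 : Matrix (Fin D) (Fin D) ℝ) i j := by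
    simp only [hT, Finset.sum_apply]
    rw [integral_const_mul, integral_finsetSum _ fun n _ => (hZs n).integrable hcc]
    simp only [hZ, h.integral_mul_eq i j]
    simp
    field_simp
  have hvar : Var[T; μ] ≤ 4 * cx ^ 4 / N := by
    rw [hT, variance_const_mul, IndepFun.variance_sum (fun n _ => hZ2 n)
      fun m _ n _ hmn => hind.indepFun hmn]
    have h1 : ∀ n, Var[Z n; μ] ≤ 4 * (cx * cx) ^ 2 := fun n =>
      (variance_le_expectation_sq (hZs n).measurable.aestronglyMeasurable).trans
        ((hZs n).integral_sq_le hcc)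
    calc (1 / (N : ℝ)) ^ 2 * ∑ n, Var[Z n; μ] ≤ (1 / (N : ℝ)) ^ 2 * ∑ _n : Fin N, 4 * (cx * cx) ^ 2 :=
          mul_le_mul_of_nonneg_left (Finset.sum_le_sum fun n _ => h1 n) (by positivity)
      _ = 4 * cx ^ 4 / N := by simp; field_simp
  simp only [hHT]
  refine ⟨(hT2.sub (memLp_const _)).integrable_sq, ?_⟩
  rw [← hmean, ← variance_eq_integral hT2.aestronglyMeasurable.aemeasurable]
  exact hvar

/-- Chebyshev's inequality for the Frobenius distance of the Gram block from the identity. -/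
theorem LinearModel.frobenius_bound [IsProbabilityMeasure μ] (h : LinearModel μ x ε θs cx ce)
    (hcx : 0 < cx) (hN : 0 < N) (S : Finset (Fin D)) :
    μ.real {ω | (1 / 16 : ℝ) ≤ ∑ i, ∑ j, (blockSS (hess (design x ω)) S i j
      - (1 : Matrix S S ℝ) i j) ^ 2} ≤ 64 * cx ^ 4 * S.card ^ 2 / N := by
  have hb : ∀ i j : S, ∀ ω, (blockSS (hess (design x ω)) S i j - (1 : Matrix S S ℝ) i j) ^ 2
      = (hess (design x ω) i j - (1 : Matrix (Fin D) (Fin D) ℝ) i j) ^ 2 := by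
    intro i j ω
    rcases eq_or_ne i j with rfl | hij
    · simp [blockSS]
    · simp [blockSS, one_apply_ne hij, one_apply_ne (Subtype.coe_ne_coe.mpr hij)]
  simp only [hb]
  have hint : ∀ i j : S, Integrable (fun ω =>
      (hess (design x ω) i j - (1 : Matrix (Fin D) (Fin D) ℝ) i j) ^ 2) μ :=
    fun i j => (h.integral_gram_sub_sq_le hcx hN i j).1
  have h1 := mul_meas_ge_le_integral_of_nonneg (μ := μ)
    (f := fun ω => ∑ i : S, ∑ j : S,
      (hess (design x ω) i j - (1 : Matrix (Fin D) (Fin D) ℝ) i j) ^ 2)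
    (Filter.Eventually.of_forall fun ω => Finset.sum_nonneg fun i _ => Finset.sum_nonneg
      fun j _ => sq_nonneg _)
    (integrable_finsetSum _ fun i _ => integrable_finsetSum _ fun j _ => hint i j) (1 / 16)
  rw [integral_finsetSum _ fun i _ => integrable_finsetSum _ fun j _ => hint i j] at h1
  have h2 : ∑ i : S, ∫ ω, ∑ j : S,
      (hess (design x ω) i j - (1 : Matrix (Fin D) (Fin D) ℝ) i j) ^ 2 ∂μ
      ≤ ∑ _i : S, ∑ _j : S, 4 * cx ^ 4 / N := by
    refine Finset.sum_le_sum fun i _ => ?_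
    rw [integral_finsetSum _ fun j _ => hint i j]
    exact Finset.sum_le_sum fun j _ => (h.integral_gram_sub_sq_le hcx hN i j).2
  have h3 : ∑ _i : S, ∑ _j : S, 4 * cx ^ 4 / N = 4 * cx ^ 4 * S.card ^ 2 / N := by
    simp; ring
  have h4 := h1.trans (h2.trans_eq h3)
  calc _ ≤ 16 * (4 * cx ^ 4 * S.card ^ 2 / N) := by linarith
    _ = _ := by ring

/-- The event on which the deterministic analysis applies: the complement of a measurable hull of
the six exceptional sets. -/
theorem LinearModel.exists_good_event [IsProbabilityMeasure μ] (h : LinearModel μ x ε θs cx ce)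
    (hcx : 0 < cx) (hce : 0 < ce) (hN : 0 < N)
    (S : Finset (Fin D)) {α q : ℝ} (hq0 : 0 ≤ q) (hq1 : q ≤ 1)
    (hq : Real.log D + 26 ≤ q ^ 2 * N)
    (hinc : 1 - Real.exp (-25) ≤ μ.real {ω | Incoherent (design x ω) S α})
    (hfrob : 64 * cx ^ 4 * S.card ^ 2 / N ≤ Real.exp (-25)) :
    ∃ E : Set Ω, MeasurableSet E ∧ 1 - 6 * Real.exp (-25) ≤ μ.real E ∧ ∀ ω ∈ E,
      Incoherent (design x ω) S α ∧
      (∀ v : S → ℝ, (3 / 4) * (v ⬝ᵥ v) ≤ v ⬝ᵥ (blockSS (hess (design x ω)) S *ᵥ v)) ∧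
      (∀ d, |(1 / (N : ℝ)) * ∑ n, ε n ω * design x ω n d| ≤ 10 * (ce * cx) * q) ∧
      (∀ n d, |ε n ω * design x ω n d| ≤ ce * cx * (Real.log (N * D) + 26)) ∧
      (∀ n, ∀ s ∈ S, |design x ω n s| ≤ √(cx ^ 2 * (Real.log (N * S.card) + 26))) ∧
      (∀ n d, |design x ω n d| ≤ √(cx ^ 2 * (Real.log (N * D) + 26))) := by
  have hN' : (0 : ℝ) < N := Nat.cast_pos.mpr hN
  set B1 := {ω | Incoherent (design x ω) S α}ᶜ with hB1
  set B2 := {ω | (1 / 16 : ℝ) ≤ ∑ i, ∑ j, (blockSS (hess (design x ω)) S i j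
      - (1 : Matrix S S ℝ) i j) ^ 2} with hB2
  set B3 := {ω | ∃ d, 10 * (ce * cx) * q * N ≤ |∑ n, ε n ω * x n d ω|} with hB3
  set B4 := {ω | ∃ p : Fin N × Fin D,
    ce * cx * (Real.log (N * D) + 26) ≤ |ε p.1 ω * x p.1 p.2 ω|} with hB4
  set B5 := {ω | ∃ p : Fin N × S,
    cx ^ 2 * (Real.log (N * S.card) + 26) ≤ |x p.1 p.2 ω ^ 2|} with hB5
  set B6 := {ω | ∃ p : Fin N × (Finset.univ : Finset (Fin D)), cx ^ 2 *
    (Real.log (N * (Finset.univ : Finset (Fin D)).card) + 26) ≤ |x p.1 p.2 ω ^ 2|} with hB6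
  set B := toMeasurable μ (B1 ∪ B2 ∪ B3 ∪ B4 ∪ B5 ∪ B6) with hB
  have hB1' : μ.real B1 ≤ Real.exp (-25) := by
    rw [hB1, probReal_compl_eq_one_sub (measurableSet_incoherent h.measurable_x S α)]
    linarith
  have hBμ : μ.real B ≤ 6 * Real.exp (-25) := by
    have e : μ.real B = μ.real (B1 ∪ B2 ∪ B3 ∪ B4 ∪ B5 ∪ B6) := by
      rw [Measure.real, Measure.real, hB, measure_toMeasurable]
    rw [e]
    have u1 := measureReal_union_le (μ := μ) (B1 ∪ B2 ∪ B3 ∪ B4 ∪ B5) B6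
    have u2 := measureReal_union_le (μ := μ) (B1 ∪ B2 ∪ B3 ∪ B4) B5
    have u3 := measureReal_union_le (μ := μ) (B1 ∪ B2 ∪ B3) B4
    have u4 := measureReal_union_le (μ := μ) (B1 ∪ B2) B3
    have u5 := measureReal_union_le (μ := μ) B1 B2
    have b2 : μ.real B2 ≤ _ := (h.frobenius_bound hcx hN S).trans hfrob
    have b3 : μ.real B3 ≤ _ := h.noise_corr_bound hcx hce hq0 hq1 hq
    have b4 : μ.real B4 ≤ _ := h.noise_mul_bound hcx hce
    have b5 : μ.real B5 ≤ _ := h.covariate_bound hcx S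
    have b6 : μ.real B6 ≤ _ := h.covariate_bound hcx Finset.univ
    linarith
  refine ⟨Bᶜ, (measurableSet_toMeasurable _ _).compl, ?_, ?_⟩
  · rw [probReal_compl_eq_one_sub (measurableSet_toMeasurable _ _)]
    linarith
  · intro ω hω
    have hω' : ω ∉ B1 ∪ B2 ∪ B3 ∪ B4 ∪ B5 ∪ B6 := fun h' => hω (subset_toMeasurable _ _ h')
    simp only [Set.mem_union, not_or] at hω'
    obtain ⟨⟨⟨⟨⟨h1, h2⟩, h3⟩, h4⟩, h5⟩, h6⟩ := hω'
    simp only [hB2, hB3, hB4, hB5, hB6, Set.mem_ofPred_eq, not_exists, not_le] at h2 h3 h4 h5 h6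
    refine ⟨not_not.mp h1, ?_, fun d => ?_, fun n d => (h4 (n, d)).le, fun n s hs => ?_,
      fun n d => ?_⟩
    · intro v
      have := coercive_of_frobenius_le (M := blockSS (hess (design x ω)) S) (r := 1 / 4) (by norm_num) (by linarith) v
      linarith
    · rw [abs_mul, abs_of_pos (by positivity), one_div, inv_mul_le_iff₀ hN', mul_comm (N : ℝ)]
      exact (h3 d).le
    · rw [← Real.sqrt_sq_eq_abs]
      exact Real.sqrt_le_sqrt ((le_abs_self _).trans (h5 (n, ⟨s, hs⟩)).le)
    · rw [← Real.sqrt_sq_eq_abs]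
      have := (h6 (n, ⟨d, Finset.mem_univ d⟩)).le
      rw [Finset.card_univ, Fintype.card_fin] at this
      exact Real.sqrt_le_sqrt ((le_abs_self _).trans this)

end Model

/-! ### Asymptotics of the explicit quantities

The growth conditions enter through `k² √k log N / N` and `k √k √(log D) / N`, where `k` is the
size of the true support. -/

theorem one_le_log_natCast {N : ℕ} (hN : 3 ≤ N) : 1 ≤ Real.log N := by
  rw [Real.le_log_iff_exp_le (by positivity)]
  have h : (3 : ℝ) ≤ N := by exact_mod_cast hN
  linarith [Real.exp_one_lt_d9]

theorem log_mul_natCast_le (m n : ℕ) : Real.log (m * n) ≤ Real.log m + Real.log n := by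
  rcases Nat.eq_zero_or_pos m with rfl | hm
  · simp [Real.log_natCast_nonneg]
  rcases Nat.eq_zero_or_pos n with rfl | hn
  · simp [Real.log_natCast_nonneg]
  rw [Real.log_mul (by positivity) (by positivity)]

theorem log_natCast_mono {m n : ℕ} (h : m ≤ n) : Real.log m ≤ Real.log n := by
  rcases Nat.eq_zero_or_pos m with rfl | hm
  · simp [Real.log_natCast_nonneg]
  · exact Real.log_le_log (by positivity) (by exact_mod_cast h)

theorem sqrt_mul_le_of_sqrt_le {a b A c : ℝ} (ha : 0 ≤ a) (h : √a ≤ A) (h' : √b ≤ c) :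
    √(a * b) ≤ A * c := by
  rw [Real.sqrt_mul ha]
  exact mul_le_mul h h' (Real.sqrt_nonneg _) ((Real.sqrt_nonneg _).trans h)

theorem MJden_eq (cx : ℝ) (N k : ℕ) : MJden cx N k = N * Lmin 1 cx N k := by
  have h : (N : ℝ) / √N = √N := Real.div_sqrt
  have h1 : N * Lmin 1 cx N k = N - 3 * cx ^ 2 * (√k + 5) * (N / √N) := by rw [Lmin]; ring
  rw [MJden, h1, h]
  ring

theorem MJ_nonneg {cx : ℝ} {N D k : ℕ} (hN : 1 ≤ N) (hden : 0 ≤ MJden cx N k) :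
    0 ≤ MJ 1 cx N D k := by
  have := Real.log_natCast_nonneg N
  rw [MJ]
  positivity

theorem MJ_first_numerator_le {A k l m r s₁ s₂ s₃ s₄ : ℝ} (hk : 0 ≤ k) (hA : 1 ≤ A) (hl : 1 ≤ l)
    (hm : 0 ≤ m) (hr : 1 ≤ r) (h0 : 0 ≤ s₃) (h0' : 0 ≤ s₄) (h1 : s₁ ≤ A) (h2 : s₂ ≤ A * (l + m))
    (h3 : s₃ ≤ A) (h4 : s₄ ≤ A * l) :
    1 * k * (s₁ + s₂) * (r + s₃ + s₄) ≤ 2 * A ^ 2 * (k * (2 * l + m) * (r + l)) := by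
  have hA0 : 0 ≤ A := by linarith
  have b1 : A ≤ A * l := le_mul_of_one_le_right hA0 hl
  have b2 : r ≤ A * r := le_mul_of_one_le_left (by linarith) hA
  have b3 : A ≤ A * r := le_mul_of_one_le_right hA0 hr
  calc 1 * k * (s₁ + s₂) * (r + s₃ + s₄)
      ≤ 1 * k * (A * (2 * l + m)) * (2 * A * (r + l)) := by
        have a1 : s₁ + s₂ ≤ A * (2 * l + m) := by linarith
        have a2 : r + s₃ + s₄ ≤ 2 * A * (r + l) := by linarith
        exact mul_le_mul (mul_le_mul_of_nonneg_left a1 (by linarith)) a2 (by linarith)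
          (by positivity)
    _ = _ := by ring

theorem MJ_second_numerator_le {A k L m r n c s₃ s₅ : ℝ} (hk : 0 ≤ k) (hA : 1 ≤ A) (hL : 1 ≤ L)
    (hn : 1 ≤ n) (hmn : m ≤ n) (hr : 1 ≤ r) (h0 : 0 ≤ s₃) (h0' : 0 ≤ s₅) (hc : c ≤ A) (h3 : s₃ ≤ A) (h5 : s₅ ≤ A * m) :
    1 * k * (k + k * c * (L + 26)) * (n + s₃ + s₅) * (n * r + s₃)
      ≤ 168 * A ^ 3 * (k ^ 2 * r * L) * n ^ 2 := by
  have hA0 : 0 ≤ A := by linarith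
  have hL0 : 0 ≤ L := by linarith
  have a1 : k + k * c * (L + 26) ≤ k * (28 * A * L) := by
    have b1 : c * (L + 26) ≤ A * (27 * L) := mul_le_mul hc (by linarith) (by linarith) hA0
    have b2 : 1 ≤ A * L := one_le_mul_of_one_le_of_one_le hA hL
    calc k + k * c * (L + 26) = k * (1 + c * (L + 26)) := by ring
      _ ≤ _ := mul_le_mul_of_nonneg_left (by linarith) hk
  have a2 : n + s₃ + s₅ ≤ 3 * A * n := by
    have b1 : n ≤ A * n := le_mul_of_one_le_left (by linarith) hA
    have b2 : A ≤ A * n := le_mul_of_one_le_right hA0 hn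
    have b3 : A * m ≤ A * n := mul_le_mul_of_nonneg_left hmn hA0
    linarith
  have hnr : 1 ≤ n * r := one_le_mul_of_one_le_of_one_le hn hr
  have a3 : n * r + s₃ ≤ 2 * A * (n * r) := by
    have b1 : n * r ≤ A * (n * r) := le_mul_of_one_le_left (by linarith) hA
    have b2 : A ≤ A * (n * r) := le_mul_of_one_le_right hA0 hnr
    linarith
  have hn0 : 0 ≤ n := by linarith
  calc _ ≤ 1 * k * (k * (28 * A * L)) * (3 * A * n) * (2 * A * (n * r)) :=
        mul_le_mul (mul_le_mul (mul_le_mul_of_nonneg_left a1 (by linarith)) a2 (by linarith)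
          (by positivity)) a3 (by linarith) (by positivity)
    _ = _ := by ring

/-- An upper bound on `M_J` once its denominator is comparable to `N`; the constant `A` absorbs all
powers of `cx`. -/
theorem MJ_le {cx A : ℝ} {N D k : ℕ} (hkD : k ≤ D) (hN : 3 ≤ N) (hDN : Real.log D ≤ N)
    (hden : (N : ℝ) / 2 ≤ MJden cx N k) (hA : 1 ≤ A) (h1 : √(50 * cx ^ 2) ≤ A)
    (h2 : √(2 * cx ^ 2) ≤ A) (h3 : √(50 * cx ^ 4) ≤ A) (h4 : √(2 * cx ^ 4) ≤ A)
    (h5 : cx ^ 2 ≤ A) :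
    MJ 1 cx N D k ≤ 4 * A ^ 2 * (4 * ((k : ℝ) ^ 2 * √k * Real.log N / N)
        + k * √k * √(Real.log D) / N + √((k : ℝ) ^ 2 * √k * Real.log N / N))
      + 672 * A ^ 3 * ((k : ℝ) ^ 2 * √k * Real.log N / N) := by
  have hN' : (0 : ℝ) < N := by positivity
  rcases Nat.eq_zero_or_pos k with rfl | hk
  · simp [MJ]
  have hk1 : (1 : ℝ) ≤ k := by exact_mod_cast hk
  have hlog := one_le_log_natCast hN
  set l := √(Real.log N) with hl
  set m := √(Real.log D) with hm
  set r := √(k : ℝ) with hr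
  set n := √(N : ℝ) with hn
  have hl2 : l ^ 2 = Real.log N := Real.sq_sqrt (by linarith)
  have hr2 : r ^ 2 = k := Real.sq_sqrt (by linarith)
  have hn2 : n ^ 2 = N := Real.sq_sqrt hN'.le
  have hl1 : 1 ≤ l := Real.one_le_sqrt.mpr hlog
  have hr1 : 1 ≤ r := Real.one_le_sqrt.mpr hk1
  have hn1 : 1 ≤ n := Real.one_le_sqrt.mpr (by exact_mod_cast (by omega : 1 ≤ N))
  have hm0 : 0 ≤ m := Real.sqrt_nonneg _
  have hmn : m ≤ n := Real.sqrt_le_sqrt hDN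
  have hDk : ((D : ℝ) - k) = ((D - k : ℕ) : ℝ) := by rw [Nat.cast_sub hkD]
  have hlogDk : Real.log ((D : ℝ) - k) ≤ Real.log D := by
    rw [hDk]; exact log_natCast_mono (Nat.sub_le _ _)
  have hs1 : √(Real.log (N * ((D : ℝ) - k))) ≤ l + m := by
    have : Real.log (N * ((D : ℝ) - k)) ≤ l ^ 2 + m ^ 2 := by
      rw [hl2, hm, Real.sq_sqrt (Real.log_natCast_nonneg _), hDk]
      refine (log_mul_natCast_le _ _).trans ?_
      rw [← hDk]; linarith
    exact Real.sqrt_le_iff.mpr ⟨by positivity, by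
      nlinarith [mul_nonneg (hl1.trans' zero_le_one) hm0]⟩
  have hs2 : √(Real.log ((D : ℝ) - k)) ≤ m := Real.sqrt_le_sqrt hlogDk
  have hA0 : 0 ≤ A := by linarith
  have e1 := sqrt_mul_le_of_sqrt_le (by positivity) h2 hs1
  have e2 : √(2 * cx ^ 4 * Real.log N) ≤ A * l :=
    sqrt_mul_le_of_sqrt_le (by positivity) h4 le_rfl
  have e3 := sqrt_mul_le_of_sqrt_le (by positivity) h4 hs2
  have e4 : √((N : ℝ) * k) = n * r := Real.sqrt_mul hN'.le _
  have n1 := MJ_first_numerator_le (hk1.trans' zero_le_one) hA hl1 hm0 hr1 (Real.sqrt_nonneg _)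
    (Real.sqrt_nonneg _) h1 e1 h3 e2
  have n2 := MJ_second_numerator_le (hk1.trans' zero_le_one) hA hlog hn1 hmn hr1
    (Real.sqrt_nonneg (50 * cx ^ 4)) (Real.sqrt_nonneg _) h5 h3 e3
  rw [← e4] at n2
  have hQ : (k : ℝ) ^ 2 * l ^ 2 ≤ k ^ 2 * r * l ^ 2 := by
    have : 0 ≤ (k : ℝ) ^ 2 * l ^ 2 := by positivity
    nlinarith
  have hden0 : 0 < MJden cx N k := by linarith
  set P := (k : ℝ) ^ 2 * r * Real.log N / N with hP
  have hPn : k ^ 2 * r * l ^ 2 = P * N := by rw [hP, hl2]; field_simp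
  have hsP : k * l ≤ √P * n := by
    rw [hn, ← Real.sqrt_mul (by positivity), ← hPn]
    exact Real.le_sqrt_of_sq_le (by rw [mul_pow]; exact hQ)
  have t1 : k * (2 * l + m) * (r + l) ≤ (4 * P + k * r * m / N + √P) * N := by
    have b1 : k * l * r ≤ P * N := by
      rw [← hPn]
      have : (k : ℝ) * l * r ≤ k * l * r * (k * l) :=
        le_mul_of_one_le_right (by positivity) (one_le_mul_of_one_le_of_one_le hk1 hl1)
      exact this.trans_eq (by ring)
    have b2 : k * l * l ≤ P * N := by
      rw [← hPn]
      have : (k : ℝ) * l * l ≤ k * l * l * (k * r) :=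
        le_mul_of_one_le_right (by positivity) (one_le_mul_of_one_le_of_one_le hk1 hr1)
      exact this.trans_eq (by ring)
    have b3 : k * l * m ≤ √P * N := by
      calc k * l * m ≤ √P * n * n := mul_le_mul hsP hmn hm0 (by positivity)
        _ = √P * N := by rw [← hn2]; ring
    have b4 : k * r * m / N * N = k * r * m := by field_simp
    calc k * (2 * l + m) * (r + l) = 2 * (k * l * r) + 2 * (k * l * l) + k * r * m + k * l * m := by
          ring
      _ ≤ 2 * (P * N) + 2 * (P * N) + k * r * m / N * N + √P * N := by rw [b4]; linarith
      _ = _ := by ring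
  rw [MJ]
  refine add_le_add ?_ ?_
  · rw [div_le_iff₀ hden0]
    calc _ ≤ 2 * A ^ 2 * ((4 * P + k * r * m / N + √P) * N) :=
          n1.trans (mul_le_mul_of_nonneg_left t1 (by positivity))
      _ = 4 * A ^ 2 * (4 * P + k * r * m / N + √P) * (N / 2) := by ring
      _ ≤ _ := mul_le_mul_of_nonneg_left hden (by positivity)
  · rw [div_le_iff₀ (by positivity)]
    calc _ ≤ 168 * A ^ 3 * (P * N) * N := n2.trans_eq (by rw [← hPn, hl2, hn2])
      _ = 672 * A ^ 3 * P * (N / 2) ^ 2 := by ring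
      _ ≤ _ := by gcongr

theorem tendsto_sq_mul_sqrt_mul_log_div {k : ℕ → ℕ}
    (h : (fun N => (k N : ℝ)) =o[atTop] (fun N : ℕ => ((N : ℝ) / Real.log N) ^ (2 / 5 : ℝ))) :
    Tendsto (fun N : ℕ => (k N : ℝ) ^ 2 * √(k N) * Real.log N / N) atTop (𝓝 0) := by
  have h1 := (h.tendsto_div_nhds_zero).rpow_const (p := (5 / 2 : ℝ)) (Or.inr (by norm_num))
  rw [Real.zero_rpow (by norm_num)] at h1
  refine h1.congr' ?_
  filter_upwards [eventually_ge_atTop 3] with N hN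
  have hlog := one_le_log_natCast hN
  have hN' : (0 : ℝ) < N := by positivity
  have hk : (0 : ℝ) ≤ k N := Nat.cast_nonneg _
  have hr : 0 < (N : ℝ) / Real.log N := div_pos hN' (by linarith)
  have e : (k N : ℝ) ^ (5 / 2 : ℝ) = k N ^ 2 * √(k N) := by
    rw [Real.sqrt_eq_rpow, ← Real.rpow_natCast, ← Real.rpow_add_of_nonneg hk (by norm_num)
      (by norm_num)]
    norm_num
  rw [Real.div_rpow hk (by positivity), ← Real.rpow_mul hr.le, e]
  norm_num
  field_simp

theorem tendsto_mul_sqrt_mul_sqrt_log_div {k D : ℕ → ℕ}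
    (h : (fun N => (k N : ℝ) ^ (3 / 2 : ℝ) * √(Real.log (D N))) =o[atTop]
      (fun N : ℕ => (N : ℝ))) :
    Tendsto (fun N : ℕ => k N * √(k N) * √(Real.log (D N)) / N) atTop (𝓝 0) := by
  refine h.tendsto_div_nhds_zero.congr fun N => ?_
  have hk : (0 : ℝ) ≤ k N := Nat.cast_nonneg _
  have e : (k N : ℝ) ^ (3 / 2 : ℝ) = k N * √(k N) := by
    rw [Real.sqrt_eq_rpow]
    nth_rewrite 2 [← Real.rpow_one (k N : ℝ)]
    rw [← Real.rpow_add_of_nonneg hk (by norm_num) (by norm_num)]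
    norm_num
  rw [e]

theorem eventually_log_add_le {D : ℕ → ℕ}
    (h : (fun N => (D N : ℝ)) =o[atTop] (fun N : ℕ => Real.exp N)) :
    ∀ᶠ N in atTop, Real.log (D N) + 26 ≤ N := by
  filter_upwards [h.bound (Real.exp_pos (-26)), eventually_ge_atTop 26] with N hN hN26
  have hN26' : (26 : ℝ) ≤ N := by exact_mod_cast hN26
  rcases Nat.eq_zero_or_pos (D N) with h0 | h0
  · rw [h0]; simpa using hN26'
  · rw [Real.norm_of_nonneg (Nat.cast_nonneg _), Real.norm_of_nonneg (Real.exp_pos _).le,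
      ← Real.exp_add] at hN
    have := (Real.log_le_iff_le_exp (by positivity)).mpr hN
    linarith

theorem sq_mul_log_le {N k : ℕ} (hN : 3 ≤ N) :
    (k : ℝ) ^ 2 * Real.log N / N ≤ (k : ℝ) ^ 2 * √k * Real.log N / N := by
  rcases Nat.eq_zero_or_pos k with rfl | hk
  · simp
  have hlog := one_le_log_natCast hN
  have hr1 : 1 ≤ √(k : ℝ) := Real.one_le_sqrt.mpr (by exact_mod_cast hk)
  gcongr
  nlinarith [sq_nonneg (k : ℝ)]

theorem tendsto_Lmin {cx : ℝ} {k : ℕ → ℕ}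
    (h : Tendsto (fun N : ℕ => (k N : ℝ) ^ 2 * √(k N) * Real.log N / N) atTop (𝓝 0)) :
    Tendsto (fun N => Lmin 1 cx N (k N)) atTop (𝓝 1) := by
  have hinv : Tendsto (fun N : ℕ => (√(N : ℝ))⁻¹) atTop (𝓝 0) :=
    tendsto_inv_atTop_zero.comp (Real.tendsto_sqrt_atTop.comp tendsto_natCast_atTop_atTop)
  have h1 : Tendsto (fun N : ℕ => √((k N : ℝ) ^ 2 * √(k N) * Real.log N / N)
      + 5 * (√(N : ℝ))⁻¹) atTop (𝓝 0) := by
    simpa using h.sqrt.add (hinv.const_mul 5)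
  have h2 : Tendsto (fun N : ℕ => (√(k N : ℝ) + 5) / √N) atTop (𝓝 0) := by
    refine tendsto_of_tendsto_of_tendsto_of_le_of_le' tendsto_const_nhds h1
      (Filter.Eventually.of_forall fun N => by positivity) ?_
    filter_upwards [eventually_ge_atTop 3] with N hN
    have hlog := one_le_log_natCast hN
    have : √(k N : ℝ) / √N ≤ √((k N : ℝ) ^ 2 * √(k N) * Real.log N / N) := by
      rw [← Real.sqrt_div (Nat.cast_nonneg _)]
      refine Real.sqrt_le_sqrt ((le_trans ?_ (sq_mul_log_le hN)))
      gcongr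
      rcases Nat.eq_zero_or_pos (k N) with h0 | h0
      · simp [h0]
      have : (1 : ℝ) ≤ k N := by exact_mod_cast h0
      nlinarith
    rw [add_div, div_eq_mul_inv 5]
    linarith
  have h3 : Tendsto (fun N : ℕ => 1 - 3 * 1 * cx ^ 2 * ((√(k N : ℝ) + 5) / √N)) atTop (𝓝 1) := by
    simpa using (h2.const_mul (3 * 1 * cx ^ 2)).const_sub 1
  refine h3.congr fun N => ?_
  rw [Lmin]; ring

theorem tendsto_MJ {cx : ℝ} {k D : ℕ → ℕ} (hkD : ∀ N, k N ≤ D N)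
    (hP : Tendsto (fun N : ℕ => (k N : ℝ) ^ 2 * √(k N) * Real.log N / N) atTop (𝓝 0))
    (hR : Tendsto (fun N : ℕ => k N * √(k N) * √(Real.log (D N)) / N) atTop (𝓝 0))
    (hD : ∀ᶠ N in atTop, Real.log (D N) + 26 ≤ N) :
    Tendsto (fun N => MJ 1 cx N (D N) (k N)) atTop (𝓝 0) := by
  obtain ⟨A, hA, h1, h2, h3, h4, h5⟩ : ∃ A : ℝ, 1 ≤ A ∧ √(50 * cx ^ 2) ≤ A ∧ √(2 * cx ^ 2) ≤ A ∧
      √(50 * cx ^ 4) ≤ A ∧ √(2 * cx ^ 4) ≤ A ∧ cx ^ 2 ≤ A := by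
    refine ⟨1 + √(50 * cx ^ 2) + √(2 * cx ^ 2) + √(50 * cx ^ 4) + √(2 * cx ^ 4) + cx ^ 2, ?_⟩
    have := Real.sqrt_nonneg (50 * cx ^ 2)
    have := Real.sqrt_nonneg (2 * cx ^ 2)
    have := Real.sqrt_nonneg (50 * cx ^ 4)
    have := Real.sqrt_nonneg (2 * cx ^ 4)
    have := sq_nonneg cx
    refine ⟨?_, ?_, ?_, ?_, ?_, ?_⟩ <;> linarith
  have hden : ∀ᶠ N : ℕ in atTop, (N : ℝ) / 2 ≤ MJden cx N (k N) := by
    filter_upwards [(tendsto_Lmin (cx := cx) hP).eventually_const_le (by norm_num : (1 / 2 : ℝ) < 1)] with N hL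
    rw [MJden_eq]
    have : (0 : ℝ) ≤ N := Nat.cast_nonneg _
    nlinarith
  have hlim : Tendsto (fun N : ℕ => 4 * A ^ 2 * (4 * ((k N : ℝ) ^ 2 * √(k N) * Real.log N / N)
        + k N * √(k N) * √(Real.log (D N)) / N + √((k N : ℝ) ^ 2 * √(k N) * Real.log N / N))
      + 672 * A ^ 3 * ((k N : ℝ) ^ 2 * √(k N) * Real.log N / N)) atTop (𝓝 0) := by
    simpa using ((((hP.const_mul 4).add hR).add hP.sqrt).const_mul (4 * A ^ 2)).add
      (hP.const_mul (672 * A ^ 3))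
  refine tendsto_of_tendsto_of_tendsto_of_le_of_le' tendsto_const_nhds hlim ?_ ?_
  · filter_upwards [hden, eventually_ge_atTop 1] with N hN hN1
    exact MJ_nonneg hN1 (le_trans (by positivity) hN)
  · filter_upwards [hden, eventually_ge_atTop 3, hD] with N hN hN3 hDN
    exact MJ_le (hkD N) hN3 (by linarith) hN hA h1 h2 h3 h4 h5

/-- The three quantities that the covariate bounds must make small: the failure probability of
coercivity, the relative change of the Gram block, and the change of a row in the incoherence
condition when a data point is left out. -/
theorem covariate_terms_le {cx P : ℝ} {N D k : ℕ} (hcx : 0 < cx) (hN : 3 ≤ N)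
    (hD : Real.log D + 26 ≤ N) (hPdef : (k : ℝ) ^ 2 * √k * Real.log N / N ≤ P) (hP : P ≤ 1) :
    64 * cx ^ 4 * (k : ℝ) ^ 2 / N ≤ 64 * cx ^ 4 * P ∧
    k * √(cx ^ 2 * (Real.log (N * k) + 26)) ^ 2 / N ≤ 28 * cx ^ 2 * P ∧
    (√(cx ^ 2 * (Real.log (N * k) + 26)) + √(cx ^ 2 * (Real.log (N * D) + 26))) / N
      * (k * √(cx ^ 2 * (Real.log (N * k) + 26)) / (1 / 2)) ≤ 96 * cx ^ 2 * √P := by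
  have hN' : (0 : ℝ) < N := by positivity
  have hlog := one_le_log_natCast hN
  have hQ : (k : ℝ) ^ 2 * Real.log N / N ≤ P := (sq_mul_log_le hN).trans hPdef
  have hQ' : (k : ℝ) ^ 2 * Real.log N ≤ P * N := by rwa [div_le_iff₀ hN'] at hQ
  have hkk : (k : ℝ) ≤ k ^ 2 := by
    have : k ≤ k ^ 2 := Nat.le_self_pow (by norm_num) k
    exact_mod_cast this
  have hk0 : (0 : ℝ) ≤ k := Nat.cast_nonneg _
  have hkN : k ≤ N := by
    have : (k : ℝ) ≤ N := by nlinarith [sq_nonneg (k : ℝ)]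
    exact_mod_cast this
  have hlogNk : Real.log (N * k) + 26 ≤ 28 * Real.log N := by
    have := log_mul_natCast_le N k
    have := log_natCast_mono hkN
    linarith
  have hlogNk0 : 0 ≤ Real.log (N * k) := by
    have := Real.log_natCast_nonneg (N * k)
    rwa [Nat.cast_mul] at this
  set l := √(Real.log N) with hl
  set n := √(N : ℝ) with hn
  have hl2 : l ^ 2 = Real.log N := Real.sq_sqrt (by linarith)
  have hn2 : n ^ 2 = N := Real.sq_sqrt hN'.le
  have hlogN : Real.log N ≤ N := (Real.log_le_sub_one_of_pos hN').trans (by linarith)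
  have hln : l ≤ n := Real.sqrt_le_sqrt hlogN
  have hn0 : 0 < n := Real.sqrt_pos.mpr hN'
  have hl0 : 0 ≤ l := Real.sqrt_nonneg _
  have hb : √(cx ^ 2 * (Real.log (N * k) + 26)) ≤ 6 * cx * l := by
    rw [Real.sqrt_le_iff]
    refine ⟨by positivity, ?_⟩
    calc cx ^ 2 * (Real.log (N * k) + 26) ≤ cx ^ 2 * (36 * Real.log N) :=
          mul_le_mul_of_nonneg_left (by linarith) (by positivity)
      _ = _ := by rw [← hl2]; ring
  have hB : √(cx ^ 2 * (Real.log (N * D) + 26)) ≤ 2 * cx * n := by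
    rw [Real.sqrt_le_iff]
    refine ⟨by positivity, ?_⟩
    have := log_mul_natCast_le N D
    calc cx ^ 2 * (Real.log (N * D) + 26) ≤ cx ^ 2 * (4 * N) :=
          mul_le_mul_of_nonneg_left (by linarith) (by positivity)
      _ = _ := by rw [← hn2]; ring
  refine ⟨?_, ?_, ?_⟩
  · rw [div_le_iff₀ hN']
    have : (k : ℝ) ^ 2 ≤ P * N := by nlinarith [sq_nonneg (k : ℝ)]
    nlinarith [pow_pos hcx 4]
  · rw [Real.sq_sqrt (by positivity), div_le_iff₀ hN']
    calc k * (cx ^ 2 * (Real.log (N * k) + 26)) ≤ k ^ 2 * (cx ^ 2 * (28 * Real.log N)) := by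
          gcongr
      _ = 28 * cx ^ 2 * (k ^ 2 * Real.log N) := by ring
      _ ≤ 28 * cx ^ 2 * (P * N) := mul_le_mul_of_nonneg_left hQ' (by positivity)
      _ = _ := by ring
  · have hkl : k * l ≤ √P * n := by
      have hP0 : 0 ≤ P := le_trans (by positivity) hQ
      rw [hn, ← Real.sqrt_mul hP0]
      exact Real.le_sqrt_of_sq_le (by rw [mul_pow, hl2]; exact hQ')
    set b := √(cx ^ 2 * (Real.log (N * k) + 26))
    set B := √(cx ^ 2 * (Real.log (N * D) + 26))
    have hb0 : 0 ≤ b := Real.sqrt_nonneg _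
    have hbB : b + B ≤ 8 * cx * n := by nlinarith
    calc (b + B) / N * (k * b / (1 / 2)) ≤ (8 * cx * n) / N * (k * (6 * cx * l) / (1 / 2)) := by
          gcongr
      _ = 96 * cx ^ 2 * (n / N) * (k * l) := by ring
      _ ≤ 96 * cx ^ 2 * (n / N) * (√P * n) := mul_le_mul_of_nonneg_left hkl (by positivity)
      _ = 96 * cx ^ 2 * √P * (n ^ 2 / N) := by ring
      _ = _ := by rw [hn2, div_self hN'.ne', mul_one]

/-- The lower bound on the regularization parameter dominates the noise level `g + e`. -/
theorem noise_le_of_lamBound_le {cx ce α lam : ℝ} {N D k : ℕ} (hcx : 0 < cx) (hce : 0 < ce)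
    (hN : 0 < N) (hlo : 7 / 8 * α ≤ α - MJ 1 cx N D k)
    (hhi : α - MJ 1 cx N D k ≤ 9 / 8 * α) (hα : 0 < α)
    (hlam : lamBound 1 (1 / 10 ^ 4) α cx ce N D k ≤ lam) :
    0 < lam ∧ 10 * (ce * cx) * √((Real.log D + 26) / N)
      + ce * cx * (Real.log (N * D) + 26) / N ≤ 3 / 8 * α * lam := by
  have hN' : (0 : ℝ) < N := by positivity
  set γ := α - MJ 1 cx N D k with hγ
  have hγ0 : 0 < γ := by linarith
  set g := 10 * (ce * cx) * √((Real.log D + 26) / N) with hg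
  set e := ce * cx * (Real.log (N * D) + 26) / N with he
  have hlogD := Real.log_natCast_nonneg D
  have hlogND : 0 ≤ Real.log (N * D) := by
    have := Real.log_natCast_nonneg (N * D)
    rwa [Nat.cast_mul] at this
  have he0 : 0 < e := by positivity
  have hg0 : 0 ≤ g := by positivity
  have h1 : 9 * g ≤ √(cx ^ 2 * ce ^ 2 * Real.log D / (N * (1 / 10 ^ 4))
      + 25 * cx ^ 2 * ce ^ 2 / (N * (1 / 10 ^ 4))) := by
    apply Real.le_sqrt_of_sq_le
    rw [hg]
    have : (9 * (10 * (ce * cx) * √((Real.log D + 26) / N))) ^ 2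
        = (cx ^ 2 * ce ^ 2 / N) * (8100 * (Real.log D + 26)) := by
      rw [mul_pow, mul_pow, Real.sq_sqrt (by positivity)]; ring
    rw [this]
    calc (cx ^ 2 * ce ^ 2 / N) * (8100 * (Real.log D + 26))
        ≤ (cx ^ 2 * ce ^ 2 / N) * (10 ^ 4 * Real.log D + 10 ^ 4 * 25) :=
          mul_le_mul_of_nonneg_left (by linarith) (by positivity)
      _ = _ := by field_simp
  have h2 : (9 * g + 4 * e) / γ ≤ lam := by
    refine le_trans ?_ hlam
    rw [lamBound, ← hγ]
    have e2 : 4 * cx * ce * (Real.log ((N : ℝ) * D) + 26) / (N * γ) = 4 * e / γ := by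
      rw [he]; field_simp
    rw [e2, add_div]
    refine add_le_add ?_ le_rfl
    rw [div_eq_inv_mul, one_div]
    exact mul_le_mul_of_nonneg_left h1 (by positivity)
  have hl0 : 0 < lam := lt_of_lt_of_le (by positivity) h2
  rw [div_le_iff₀ hγ0] at h2
  exact ⟨hl0, by nlinarith⟩

end SparseLOO

open SparseLOO in
theorem mainTheorem1 :
    ∃ C > (0 : ℝ), ∃ C' > (0 : ℝ),
    ∀ (cx ce α : ℝ), 0 < cx → 0 < ce → 0 < α →
    ∀ (D : ℕ → ℕ) (θs : (N : ℕ) → Fin (D N) → ℝ) (deff : ℕ → ℕ) (lam : ℕ → ℝ)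
      (Ω : ℕ → Type*) [∀ N, MeasurableSpace (Ω N)]
      (μ : (N : ℕ) → Measure (Ω N)) [∀ N, IsProbabilityMeasure (μ N)]
      (x : (N : ℕ) → Fin N → Fin (D N) → Ω N → ℝ) (ε : (N : ℕ) → Fin N → Ω N → ℝ),
      (∀ N, deff N = (SparseLOO.supp (θs N)).card) →
      (∀ N, SparseLOO.LinearModel (μ N) (x N) (ε N) (θs N) cx ce) →
      -- incoherence with high probability
      (∀ᶠ N in atTop, 1 - Real.exp (-25) ≤
        (μ N).real {ω | SparseLOO.Incoherent (SparseLOO.design (x N) ω)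
          (SparseLOO.supp (θs N)) α}) →
      -- growth of the dimension and of the size of the true support
      (fun N => (D N : ℝ)) =o[atTop] (fun N => Real.exp N) →
      (fun N => (deff N : ℝ)) =o[atTop] (fun N => ((N : ℝ) / Real.log N) ^ (2 / 5 : ℝ)) →
      (fun N => (deff N : ℝ) ^ (3 / 2 : ℝ) * √(Real.log (D N))) =o[atTop] (fun N => (N : ℝ)) →
      -- beta-min condition
      (∀ᶠ N in atTop, ∀ s ∈ SparseLOO.supp (θs N),
        √(deff N) * SparseLOO.Tmin C α cx N (D N) (deff N) * lam N < |θs N s|) →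
      -- lower bound on the regularization parameter
      (∀ᶠ N in atTop, SparseLOO.lamBound C C' α cx ce N (D N) (deff N) ≤ lam N) →
      Tendsto (fun N => SparseLOO.MJ C cx N (D N) (deff N)) atTop (𝓝 0) ∧
      ∀ᶠ N in atTop, ∃ E : Set (Ω N), MeasurableSet E ∧
        1 - 26 * Real.exp (-25) ≤ (μ N).real E ∧
        ∀ ω ∈ E, SparseLOO.SupportStable (SparseLOO.design (x N) ω)
          (SparseLOO.response (x N) (ε N) (θs N) ω) (lam N) (SparseLOO.supp (θs N)) := by
  -- `C' = 10⁻⁴` turns the square root in the bound on `lam` into more than nine times the bound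
  -- on the correlation of noise and covariates
  refine ⟨1, one_pos, 1 / 10 ^ 4, by norm_num, ?_⟩
  intro cx ce α hcx hce hα D θs deff lam Ω _ μ _ x ε hdeff hmodel hinc hDo hko hRo hβ hlam
  have hkD : ∀ N, deff N ≤ D N := fun N => by
    rw [hdeff N]; exact (Finset.card_le_univ _).trans_eq (Fintype.card_fin _)
  have hP := tendsto_sq_mul_sqrt_mul_log_div hko
  have hR := tendsto_mul_sqrt_mul_sqrt_log_div hRo
  have hD := eventually_log_add_le hDo
  have hMJ := tendsto_MJ (cx := cx) hkD hP hR hD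
  refine ⟨hMJ, ?_⟩
  have hP1 := hP.eventually_le_const one_pos
  have hP2 : ∀ᶠ N : ℕ in atTop,
      64 * cx ^ 4 * ((deff N : ℝ) ^ 2 * √(deff N) * Real.log N / N) ≤ Real.exp (-25) := by
    have h := hP.const_mul (64 * cx ^ 4)
    rw [mul_zero] at h
    exact h.eventually_le_const (Real.exp_pos _)
  have hP3 : ∀ᶠ N : ℕ in atTop,
      28 * cx ^ 2 * ((deff N : ℝ) ^ 2 * √(deff N) * Real.log N / N) ≤ 1 / 32 := by
    have h := hP.const_mul (28 * cx ^ 2)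
    rw [mul_zero] at h
    exact h.eventually_le_const (by norm_num)
  have hP4 : ∀ᶠ N : ℕ in atTop,
      96 * cx ^ 2 * √((deff N : ℝ) ^ 2 * √(deff N) * Real.log N / N) ≤ α / 8 := by
    have h := hP.sqrt.const_mul (96 * cx ^ 2)
    rw [Real.sqrt_zero, mul_zero] at h
    exact h.eventually_le_const (by positivity)
  -- the bounds `±α / 8` on `M_J` keep `γ = α - M_J` within the factors `7 / 8` and `9 / 8` of `α`
  filter_upwards [hP1, hP2, hP3, hP4, hD, hinc, hβ, hlam, eventually_ge_atTop 3,
    hMJ.eventually_le_const (by positivity : 0 < α / 8),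
    hMJ.eventually_const_le (by linarith : -(α / 8) < 0),
    (tendsto_Lmin (cx := cx) hP).eventually_const_le (by norm_num : (1 / 2 : ℝ) < 1)]
    with N hP1 hP2 hP3 hP4 hD hinc hβ hlam hN hMJu hMJl hL
  have hN0 : 0 < N := by omega
  have hN' : (0 : ℝ) < N := Nat.cast_pos.mpr hN0
  have hlogD := Real.log_natCast_nonneg (D N)
  have hlogND : 0 ≤ Real.log (N * D N) := by
    have := Real.log_natCast_nonneg (N * D N)
    rwa [Nat.cast_mul] at this
  obtain ⟨hc1, hc2, hc3⟩ := covariate_terms_le hcx hN hD le_rfl hP1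
  obtain ⟨hlam0, hnoise⟩ := noise_le_of_lamBound_le (k := deff N) hcx hce hN0 (by linarith)
    (by linarith) hα hlam
  set q := √((Real.log (D N) + 26) / N) with hq
  have hq1 : q ≤ 1 := by
    rw [hq, Real.sqrt_le_one, div_le_one hN']; exact hD
  have hq2 : Real.log (D N) + 26 ≤ q ^ 2 * N := by
    rw [hq, Real.sq_sqrt (by positivity), div_mul_cancel₀ _ hN'.ne']
  obtain ⟨E, hE, hEμ, hEω⟩ := (hmodel N).exists_good_event hcx hce hN0 (supp (θs N)) (α := α)
    (Real.sqrt_nonneg _) hq1 hq2 hinc (by rw [← hdeff]; exact hc1.trans hP2)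
  -- the six exceptional sets leave room in the allowance of twenty-six
  refine ⟨E, hE, by linarith [Real.exp_pos (-25)], fun ω hω => ?_⟩
  obtain ⟨i1, i2, i3, i4, i5, i6⟩ := hEω ω hω
  rw [← hdeff] at i5
  refine supportStable_of_bounds (design (x N) ω) (fun n => ε N n ω) (θs N) (supp (θs N)) hN0 rfl
    hα hlam0 (Real.sqrt_nonneg _) (by positivity) ?_ i1 i2 i3 (e := ce * cx *
      (Real.log (N * D N) + 26) / N) (fun n d => ?_) i5 i6 ?_ ?_ hnoise fun s hs => ?_
  · positivity
  · rw [mul_div_cancel₀ _ hN'.ne']; exact i4 n d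
  · rw [← hdeff]; exact hc2.trans hP3
  · rw [← hdeff]; exact hc3.trans hP4
  · refine lt_of_le_of_lt ?_ (hβ s hs)
    rw [← hdeff]
    have hL1 : Lmin 1 cx N (deff N) ≤ 1 := by
      rw [Lmin, sub_le_self_iff]; positivity
    have hT : 4 ≤ Tmin 1 α cx N (D N) (deff N) := by
      rw [Tmin, le_div_iff₀ (by linarith)]
      linarith
    gcongr
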